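/- Let $n\ge 3$, $2^*=\frac{2n}{n-2}$, $\mathbb{R}^n_+=\{x\in\mathbb{R}^n : x_1>0\}$, and for $1\le j\le n$ put $|\mathbf{X}_j|^2=x_1^2+\dots+x_j^2$ (so $|\mathbf{X}_n|=|x|$). Functions are real-valued. (i) Let $1\le k<n$. For every real $\beta_n<\frac14$ there is a constant $C>0$ such that for all $u\in C_0^\infty(\mathbb{R}^n_+)$ $$\int_{\mathbb{R}^n_+}|\nabla u|^2\,dx\ \ge\ \int_{\mathbb{R}^n_+}\left(\frac{k^2}{4}\frac{1}{|\mathbf{X}_k|^2}+\frac14\frac{1}{|\mathbf{X}_{k+1}|^2}+\dots+\frac14\frac{1}{|\mathbf{X}_{n-1}|^2}+\frac{\beta_n}{|\mathbf{X}_n|^2}\right)|u|^2\,dx+C\left(\int_{\mathbb{R}^n_+}|u|^{2^*}dx\right)^{2/2^*}.$$ (For $k=n-1$ the terms with weight $\frac14$ are absent.) If $\beta_n=\frac14$, there is no constant $C>0$ for which this inequality holds for all $u\in C_0^\infty(\mathbb{R}^n_+)$. (ii) For every real $\beta_n<\frac{n^2}{4}$ there is a constant $C>0$ such that for all $u\in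 C_0^\infty(\mathbb{R}^n_+)$ $$\int_{\mathbb{R}^n_+}|\nabla u|^2\,dx\ \ge\ \beta_n\int_{\mathbb{R}^n_+}\frac{|u|^2}{|x|^2}\,dx+C\left(\int_{\mathbb{R}^n_+}|u|^{2^*}dx\right)^{2/2^*}.$$ If $\beta_n=\frac{n^2}{4}$, there is no constant $C>0$ for which this inequality holds for all $u\in C_0^\infty(\mathbb{R}^n_+)$. -/

import Mathlib

noncomputable section

namespace HalfSpaceHardy

/-- The open half-space `x₁ > 0` of `ℝⁿ` (coordinates are numbered from `0` in `Fin n`, so `x₁` is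
the coordinate of index `0`). -/
def halfSpace (n : ℕ) : Set (EuclideanSpace ℝ (Fin n)) :=
  {x | ∃ h : 0 < n, 0 < x ⟨0, h⟩}

/-- `|X_j|² = x₁² + … + x_j²`, the sum of the squares of the first `j` coordinates. -/
def partialNormSq {n : ℕ} (j : ℕ) (x : EuclideanSpace ℝ (Fin n)) : ℝ :=
  ∑ i ∈ Finset.univ.filter (fun i : Fin n => (i : ℕ) < j), x i ^ 2

/-- `u ∈ C_c^∞(Ω)`: a smooth function whose support is a compact subset of `Ω`
(extended by zero to the whole space). -/
structure IsTestFunction {n : ℕ} (Ω : Set (EuclideanSpace ℝ (Fin n)))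
    (u : EuclideanSpace ℝ (Fin n) → ℝ) : Prop where
  smooth : ContDiff ℝ (⊤ : ℕ∞) u
  compactSupport : HasCompactSupport u
  support_subset : tsupport u ⊆ Ω

/-- The critical Sobolev exponent `2* = 2n/(n-2)`. -/
def criticalExponent (n : ℕ) : ℝ := 2 * (n : ℝ) / ((n : ℝ) - 2)

/-- The inequality `∫ |∇u|² ≥ ∫ V |u|² + C (∫ |u|^{2*})^{2/2*}` on the half-space, for all
`u ∈ C_c^∞` of the half-space. -/
def HardySobolevMazya (n : ℕ) (V : EuclideanSpace ℝ (Fin n) → ℝ) (C : ℝ) : Prop :=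
  ∀ u : EuclideanSpace ℝ (Fin n) → ℝ, IsTestFunction (halfSpace n) u →
    (∫ x in halfSpace n, V x * |u x| ^ 2)
        + C * (∫ x in halfSpace n, |u x| ^ criticalExponent n) ^ (2 / criticalExponent n)
      ≤ ∫ x in halfSpace n, ‖gradient u x‖ ^ 2

/-- The potential `(k²/4)/|X_k|² + (1/4)/|X_{k+1}|² + … + (1/4)/|X_{n-1}|² + β/|X_n|²`. -/
def hardyPotential (n k : ℕ) (β : ℝ) (x : EuclideanSpace ℝ (Fin n)) : ℝ :=
  ((k : ℝ) ^ 2 / 4) / partialNormSq k x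
    + ∑ j ∈ Finset.Icc (k + 1) (n - 1), (1 / 4 : ℝ) / partialNormSq j x
    + β / partialNormSq n x

end HalfSpaceHardy

end

namespace HalfSpaceHardy

open MeasureTheory Set Filter Topology

noncomputable section

variable {n : ℕ}

/-! Everything rests on ground states Φ = ∏ |X_j|^{s_j - s_{j-1}} with s_0 = 0. Since X_i · X_j =
|X_{min(i,j)}|², the field ∇ log Φ (`drift`) has explicit norm and divergence. With W = ∇u - u ∇ log
Φ, integration by parts gives ∫|W|² = ∫|∇u|² plus an explicit combination of the ∫u²/|X_j|²
(`energy_identity`). The exponents in `groundExp` reproduce the Hardy potential, with free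
parameters τ_j completing the squares. Part (ii) is the case k = n, the last coefficient being
counted from n²/4.

Below the critical coefficient, τ_n > 0 is the only nonzero parameter and the potential is matched
exactly, so it remains to bound ∫|W|² below by the critical norm (`sobolev_energy`). The L¹ Sobolev
inequality is applied to |u|^q, q = 2(n-1)/(n-2). The drift part of ∇|u|^q is controlled by
integrals of |u|^q/|X_j|, and these by ∫|u|^{q-1}|W| (`weighted_hardy`), provided q s_j + j - 1 > 0.
Cauchy–Schwarz then finishes. At j = n this condition is exactly τ_n > 0.

At the critical coefficient, take u = Φv with v cutting off near the boundary (width δ) and at |log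
|x|²| ~ m. When τ_n = 0, Φ²/|x|² is homogeneous of degree -n, so its integral over the cutoff region
is O(m), and the logarithmic cutoff costs O(m)/m². For k < n the boundary cutoff diverges
logarithmically at τ = 0; hence tiny τ_j > 0 for j < n, chosen so that every error in the potential
has a good sign except the last, which costs O(1/m²)·O(m) (`critical_energy_le`, `perturbation`).
Letting δ → 0 and then m → ∞, the deficit tends to 0 while ∫|u|^{2*} stays bounded below
(`exists_le_integral_groundState_mul`). -/

/-! ### Partial norms and coordinate projections -/

/-- The projection of `ℝⁿ` onto the first `j` coordinates. -/
def headProj (j : ℕ) (x : EuclideanSpace ℝ (Fin n)) : EuclideanSpace ℝ (Fin n) :=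
  WithLp.toLp 2 fun i => if (i : ℕ) < j then x i else 0

theorem headProj_apply (j : ℕ) (x : EuclideanSpace ℝ (Fin n)) (i : Fin n) :
    headProj j x i = if (i : ℕ) < j then x i else 0 := rfl

theorem partialNormSq_eq (j : ℕ) (x : EuclideanSpace ℝ (Fin n)) :
    partialNormSq j x = ∑ i : Fin n, if (i : ℕ) < j then x i ^ 2 else 0 := by
  rw [partialNormSq, Finset.sum_filter]

/-- The nested structure of the X_j enters through this identity: all inner products in the argument
become single partial norms. -/
theorem inner_headProj (i j : ℕ) (x : EuclideanSpace ℝ (Fin n)) :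
    inner ℝ (headProj i x) (headProj j x) = partialNormSq (min i j) x := by
  simp only [PiLp.inner_apply, partialNormSq_eq, headProj_apply, lt_min_iff]
  refine Finset.sum_congr rfl fun l _ => ?_
  by_cases h1 : (l : ℕ) < i <;> by_cases h2 : (l : ℕ) < j <;> simp [h1, h2, pow_two]

theorem norm_headProj_sq (j : ℕ) (x : EuclideanSpace ℝ (Fin n)) :
    ‖headProj j x‖ ^ 2 = partialNormSq j x := by
  rw [← real_inner_self_eq_norm_sq, inner_headProj, min_self]

theorem norm_headProj (j : ℕ) (x : EuclideanSpace ℝ (Fin n)) :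
    ‖headProj j x‖ = √(partialNormSq j x) := by
  rw [← norm_headProj_sq, Real.sqrt_sq (norm_nonneg _)]

theorem headProj_self (x : EuclideanSpace ℝ (Fin n)) : headProj n x = x := by
  ext i; simp [headProj_apply]

theorem partialNormSq_self (x : EuclideanSpace ℝ (Fin n)) : partialNormSq n x = ‖x‖ ^ 2 := by
  rw [← norm_headProj_sq, headProj_self]

theorem partialNormSq_nonneg (j : ℕ) (x : EuclideanSpace ℝ (Fin n)) : 0 ≤ partialNormSq j x :=
  Finset.sum_nonneg fun _ _ => sq_nonneg _

theorem partialNormSq_mono {i j : ℕ} (h : i ≤ j) (x : EuclideanSpace ℝ (Fin n)) :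
    partialNormSq i x ≤ partialNormSq j x := by
  rw [partialNormSq, partialNormSq]
  refine Finset.sum_le_sum_of_subset_of_nonneg (fun l hl => ?_) fun _ _ _ => sq_nonneg _
  simp only [Finset.mem_filter, Finset.mem_univ, true_and] at hl ⊢
  omega

theorem sq_le_partialNormSq {j : ℕ} (x : EuclideanSpace ℝ (Fin n)) (i : Fin n) (h : (i : ℕ) < j) :
    x i ^ 2 ≤ partialNormSq j x := by
  rw [partialNormSq]
  exact Finset.single_le_sum (f := fun l => x l ^ 2) (fun _ _ => sq_nonneg _) (by simpa using h)

theorem partialNormSq_smul (j : ℕ) (c : ℝ) (x : EuclideanSpace ℝ (Fin n)) :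
    partialNormSq j (c • x) = c ^ 2 * partialNormSq j x := by
  simp [partialNormSq, mul_pow, Finset.mul_sum]

theorem mem_halfSpace (hn : 0 < n) {x : EuclideanSpace ℝ (Fin n)} :
    x ∈ halfSpace n ↔ 0 < x ⟨0, hn⟩ := by
  simp [halfSpace, hn]

theorem partialNormSq_one (hn : 0 < n) (x : EuclideanSpace ℝ (Fin n)) :
    partialNormSq 1 x = x ⟨0, hn⟩ ^ 2 := by
  rw [partialNormSq]
  have : (Finset.univ.filter fun i : Fin n => (i : ℕ) < 1) = {⟨0, hn⟩} := by
    ext i; simp [Fin.ext_iff]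
  rw [this, Finset.sum_singleton]

theorem partialNormSq_pos {j : ℕ} (hj : 0 < j) {x : EuclideanSpace ℝ (Fin n)}
    (hx : x ∈ halfSpace n) : 0 < partialNormSq j x := by
  obtain ⟨hn, h⟩ := hx
  exact lt_of_lt_of_le (by positivity) (sq_le_partialNormSq x ⟨0, hn⟩ hj)

theorem isOpen_halfSpace : IsOpen (halfSpace n) := by
  rcases Nat.eq_zero_or_pos n with rfl | hn
  · simp [halfSpace]
  · have : halfSpace n = {x | 0 < x ⟨0, hn⟩} := by ext x; exact mem_halfSpace hn
    rw [this]
    exact isOpen_lt continuous_const (by fun_prop)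

theorem contDiff_partialNormSq (j : ℕ) {m : WithTop ℕ∞} :
    ContDiff ℝ m (partialNormSq j : EuclideanSpace ℝ (Fin n) → ℝ) := by
  unfold partialNormSq
  fun_prop

theorem continuous_partialNormSq (j : ℕ) :
    Continuous (partialNormSq j : EuclideanSpace ℝ (Fin n) → ℝ) :=
  (contDiff_partialNormSq (m := 0) j).continuous

theorem continuous_headProj (j : ℕ) :
    Continuous (headProj j : EuclideanSpace ℝ (Fin n) → EuclideanSpace ℝ (Fin n)) := by
  unfold headProj
  refine (PiLp.continuous_toLp 2 _).comp (continuous_pi fun i => ?_)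
  split_ifs <;> fun_prop

theorem hasGradientAt_partialNormSq (j : ℕ) (x : EuclideanSpace ℝ (Fin n)) :
    HasGradientAt (partialNormSq j) ((2 : ℝ) • headProj j x) x := by
  rw [hasGradientAt_iff_hasFDerivAt]
  have h : HasFDerivAt (fun y : EuclideanSpace ℝ (Fin n) =>
      ∑ i ∈ Finset.univ.filter (fun i : Fin n => (i : ℕ) < j), y i ^ 2)
      (∑ i ∈ Finset.univ.filter (fun i : Fin n => (i : ℕ) < j),
        ((2 : ℕ) • x i ^ (2 - 1)) • (EuclideanSpace.proj i : EuclideanSpace ℝ (Fin n) →L[ℝ] ℝ)) x :=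
    HasFDerivAt.fun_sum fun i _ =>
      ((EuclideanSpace.proj (𝕜 := ℝ) i).hasFDerivAt (x := x)).pow 2
  refine h.congr_fderiv ?_
  ext v
  simp only [Finset.sum_filter, sum_apply]
  simp only [map_smul, InnerProductSpace.toDual_apply_apply, smul_apply,
    PiLp.inner_apply, headProj_apply, Finset.smul_sum]
  refine Finset.sum_congr rfl fun i _ => ?_
  split_ifs
  · simp; ring
  · simp

theorem hasFDerivAt_partialNormSq_rpow (j : ℕ) (α : ℝ) {x : EuclideanSpace ℝ (Fin n)}
    (hx : 0 < partialNormSq j x) :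
    HasFDerivAt (fun y => partialNormSq j y ^ α)
      ((α * partialNormSq j x ^ (α - 1)) •
        InnerProductSpace.toDual ℝ _ ((2 : ℝ) • headProj j x)) x :=
  (hasGradientAt_partialNormSq j x).hasFDerivAt.rpow_const (Or.inl hx.ne')

/-! ### Integration by parts against radial fields -/

/-- A function which is continuous on the half-space, multiplied by a continuous function with
compact support in the half-space, is continuous with compact support. -/
theorem continuous_mul_of_tsupport {c g : EuclideanSpace ℝ (Fin n) → ℝ}
    (hc : ContinuousOn c (halfSpace n)) (hg : Continuous g) (hs : tsupport g ⊆ halfSpace n) :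
    Continuous fun x => c x * g x :=
  (hc.mul hg.continuousOn).continuous_of_tsupport_subset isOpen_halfSpace
    (tsupport_mul_subset_right.trans hs)

theorem integrable_mul_of_tsupport {c g : EuclideanSpace ℝ (Fin n) → ℝ}
    (hc : ContinuousOn c (halfSpace n)) (hg : Continuous g) (hgc : HasCompactSupport g)
    (hs : tsupport g ⊆ halfSpace n) : Integrable fun x => c x * g x :=
  (continuous_mul_of_tsupport hc hg hs).integrable_of_hasCompactSupport hgc.mul_left

theorem continuousOn_partialNormSq_rpow {j : ℕ} (hj : 0 < j) (α : ℝ) :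
    ContinuousOn (fun x : EuclideanSpace ℝ (Fin n) => partialNormSq j x ^ α) (halfSpace n) :=
  (continuous_partialNormSq j).continuousOn.rpow_const
    fun _ hx => Or.inl (partialNormSq_pos hj hx).ne'

theorem sum_single_headProj (j : ℕ) (x : EuclideanSpace ℝ (Fin n)) :
    headProj j x = ∑ i ∈ Finset.univ.filter (fun i : Fin n => (i : ℕ) < j),
      x i • EuclideanSpace.single i (1 : ℝ) := by
  ext l
  rw [WithLp.ofLp_sum, Finset.sum_apply]
  simp [headProj_apply]

/-- Integration by parts in one coordinate. -/
theorem integral_mul_fderiv_single {g c c' : EuclideanSpace ℝ (Fin n) → ℝ} (i : Fin n)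
    (hg : ContDiff ℝ 1 g) (hgc : HasCompactSupport g) (hs : tsupport g ⊆ halfSpace n)
    (hc : ContinuousOn c (halfSpace n)) (hc' : ContinuousOn c' (halfSpace n))
    (hd : ∀ x ∈ halfSpace n, HasLineDerivAt ℝ c (c' x) x (EuclideanSpace.single i 1)) :
    ∫ x, c x * fderiv ℝ g x (EuclideanSpace.single i 1) = - ∫ x, c' x * g x := by
  have hg' : Continuous fun x => fderiv ℝ g x (EuclideanSpace.single i 1) :=
    (hg.continuous_fderiv (by norm_num)).clm_apply continuous_const
  have hs' : tsupport (fun x => fderiv ℝ g x (EuclideanSpace.single i 1)) ⊆ tsupport g :=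
    (tsupport_comp_subset (g := fun L : EuclideanSpace ℝ (Fin n) →L[ℝ] ℝ =>
      L (EuclideanSpace.single i 1)) (by simp) (fderiv ℝ g)).trans (tsupport_fderiv_subset ℝ)
  refine integral_bilinear_hasLineDerivAt_right_eq_neg_left_of_integrable
    (B := ContinuousLinearMap.mul ℝ ℝ) (v := EuclideanSpace.single i 1) ?_ ?_ ?_ ?_ ?_
  · exact integrable_mul_of_tsupport hc' hg.continuous hgc hs
  · exact integrable_mul_of_tsupport hc hg' (hgc.of_isClosed_subset (isClosed_tsupport _) hs')
      (hs'.trans hs)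
  · exact integrable_mul_of_tsupport hc hg.continuous hgc hs
  · exact fun x hx => hd x (hs hx)
  · exact fun x _ => (hg.differentiable (by norm_num) x).hasFDerivAt.hasLineDerivAt _

theorem continuous_fderiv_headProj {g : EuclideanSpace ℝ (Fin n) → ℝ} (hg : ContDiff ℝ 1 g)
    (j : ℕ) : Continuous fun x => fderiv ℝ g x (headProj j x) :=
  (hg.continuous_fderiv (by norm_num)).clm_apply (continuous_headProj j)

theorem tsupport_fderiv_headProj (g : EuclideanSpace ℝ (Fin n) → ℝ) (j : ℕ) :
    tsupport (fun x => fderiv ℝ g x (headProj j x)) ⊆ tsupport g := by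
  refine closure_minimal (fun x hx => ?_) (isClosed_tsupport g)
  by_contra h
  have : fderiv ℝ g x = 0 := by
    by_contra h'
    exact h (tsupport_fderiv_subset ℝ (subset_tsupport _ h'))
  simp [this] at hx

/-- `∫ ∇g · X_j |X_j|^{2α} = -(j + 2α) ∫ g |X_j|^{2α}`. -/
theorem integral_fderiv_headProj_mul_rpow {g : EuclideanSpace ℝ (Fin n) → ℝ}
    (hg : ContDiff ℝ 1 g) (hgc : HasCompactSupport g) (hs : tsupport g ⊆ halfSpace n)
    {j : ℕ} (hj : 0 < j) (hjn : j ≤ n) (α : ℝ) :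
    ∫ x, partialNormSq j x ^ α * fderiv ℝ g x (headProj j x)
      = -(j + 2 * α) * ∫ x, partialNormSq j x ^ α * g x := by
  set S := Finset.univ.filter (fun i : Fin n => (i : ℕ) < j) with hS
  -- This is ∂_i (x_i |X_j|^{2α}) for i among the first j coordinates; summed over these i it gives
  -- (j + 2α)|X_j|^{2α}.
  let c' : Fin n → EuclideanSpace ℝ (Fin n) → ℝ := fun i x =>
    partialNormSq j x ^ α + 2 * α * (partialNormSq j x ^ (α - 1) * x i ^ 2)
  have hcoord (i : Fin n) : ContinuousOn (fun x : EuclideanSpace ℝ (Fin n) => x i)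
    (halfSpace n) := by fun_prop
  have hc (i : Fin n) : ContinuousOn (fun x : EuclideanSpace ℝ (Fin n) =>
      x i * partialNormSq j x ^ α) (halfSpace n) :=
    (hcoord i).mul (continuousOn_partialNormSq_rpow hj α)
  have hc' (i : Fin n) : ContinuousOn (c' i) (halfSpace n) :=
    (continuousOn_partialNormSq_rpow hj α).add (continuousOn_const.mul
      ((continuousOn_partialNormSq_rpow hj (α - 1)).mul ((hcoord i).pow 2)))
  have key (i : Fin n) (hi : i ∈ S) :
      ∫ x, (x i * partialNormSq j x ^ α) * fderiv ℝ g x (EuclideanSpace.single i 1)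
        = - ∫ x, c' i x * g x := by
    refine integral_mul_fderiv_single i hg hgc hs (hc i) (hc' i) fun x hx => ?_
    have h := ((EuclideanSpace.proj (𝕜 := ℝ) i).hasFDerivAt (x := x)).mul
      (hasFDerivAt_partialNormSq_rpow j α (partialNormSq_pos hj hx))
    have hij : (i : ℕ) < j := by simpa [hS] using hi
    have h' := h.hasLineDerivAt (EuclideanSpace.single i 1)
    have e : c' i x = (((EuclideanSpace.proj (𝕜 := ℝ) i) x • (α * partialNormSq j x ^ (α - 1)) •
        InnerProductSpace.toDual ℝ (EuclideanSpace ℝ (Fin n)) ((2 : ℝ) • headProj j x)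
        + partialNormSq j x ^ α • EuclideanSpace.proj (𝕜 := ℝ) i) :
          EuclideanSpace ℝ (Fin n) →L[ℝ] ℝ) (EuclideanSpace.single i 1) := by
      simp [c', EuclideanSpace.inner_single_right, headProj_apply, hij]
      ring
    rw [e]
    exact h'
  have hint (i : Fin n) : Integrable fun x =>
      (x i * partialNormSq j x ^ α) * fderiv ℝ g x (EuclideanSpace.single i 1) := by
    have hs' : tsupport (fun x => fderiv ℝ g x (EuclideanSpace.single i 1)) ⊆ tsupport g :=
      (tsupport_comp_subset (g := fun L : EuclideanSpace ℝ (Fin n) →L[ℝ] ℝ =>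
        L (EuclideanSpace.single i 1)) (by simp) (fderiv ℝ g)).trans (tsupport_fderiv_subset ℝ)
    exact integrable_mul_of_tsupport (hc i)
      ((hg.continuous_fderiv (by norm_num)).clm_apply continuous_const)
      (hgc.of_isClosed_subset (isClosed_tsupport _) hs') (hs'.trans hs)
  have hint' (i : Fin n) : Integrable fun x => c' i x * g x :=
    integrable_mul_of_tsupport (hc' i) hg.continuous hgc hs
  have hcard : S.card = j := by
    rw [hS, Fin.card_filter_val_lt, min_eq_right hjn]
  calc ∫ x, partialNormSq j x ^ α * fderiv ℝ g x (headProj j x)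
      = ∫ x, ∑ i ∈ S, (x i * partialNormSq j x ^ α)
          * fderiv ℝ g x (EuclideanSpace.single i 1) := by
        refine integral_congr_ae (Eventually.of_forall fun x => ?_)
        simp only [sum_single_headProj, map_sum, map_smul, smul_eq_mul, Finset.mul_sum]
        exact Finset.sum_congr rfl fun i _ => by ring
    _ = - ∫ x, ∑ i ∈ S, c' i x * g x := by
        rw [integral_finsetSum _ fun i _ => hint i, integral_finsetSum _ fun i _ => hint' i,
          ← Finset.sum_neg_distrib]
        exact Finset.sum_congr rfl key
    _ = - ∫ x, (j + 2 * α) * (partialNormSq j x ^ α * g x) := by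
        congr 1
        refine integral_congr_ae (Eventually.of_forall fun x => ?_)
        simp only
        by_cases hx : x ∈ halfSpace n
        · have hN := partialNormSq_pos hj hx
          have h1 : partialNormSq j x ^ (α - 1) * partialNormSq j x = partialNormSq j x ^ α := by
            rw [Real.rpow_sub_one hN.ne', div_mul_cancel₀ _ hN.ne']
          rw [← Finset.sum_mul, Finset.sum_add_distrib, Finset.sum_const, hcard, nsmul_eq_mul,
            ← Finset.mul_sum, ← Finset.mul_sum, ← partialNormSq, h1]
          ring
        · have : g x = 0 := image_eq_zero_of_notMem_tsupport fun h => hx (hs h)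
          simp [this]
    _ = _ := by rw [integral_const_mul]; ring

/-! ### The drift field and the energy identity -/

/-- The vector field `∑_{j ≤ m} (s_j - s_{j-1}) X_j / |X_j|²`; it is the logarithmic gradient of
`∏_{j ≤ m} |X_j|^{s_j - s_{j-1}}`. -/
def drift (s : ℕ → ℝ) (m : ℕ) (x : EuclideanSpace ℝ (Fin n)) : EuclideanSpace ℝ (Fin n) :=
  ∑ j ∈ Finset.range m, ((s (j + 1) - s j) * (partialNormSq (j + 1) x)⁻¹) • headProj (j + 1) x

/-- The coefficient of `-1/|X_{j+1}|²` in the potential with ground state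
`∏_j |X_j|^{s_j - s_{j-1}}`. -/
def driftCoeff (s : ℕ → ℝ) (j : ℕ) : ℝ :=
  (s (j + 1) - s j) * ((j : ℝ) - 1) + (s (j + 1) ^ 2 - s j ^ 2)

/-- Each factor |X_j|^{-2} cancels against X_j · X_l = |X_j|², and the increments of s telescope.
Equivalently, the product of the first m factors is homogeneous of degree s_m in the first l
coordinates. -/
theorem inner_drift_headProj {s : ℕ → ℝ} (hs : s 0 = 0) {m l : ℕ} (hml : m ≤ l)
    {x : EuclideanSpace ℝ (Fin n)} (hx : x ∈ halfSpace n) :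
    inner ℝ (drift s m x) (headProj l x) = s m := by
  have h : ∀ j ∈ Finset.range m, inner ℝ
      (((s (j + 1) - s j) * (partialNormSq (j + 1) x)⁻¹) • headProj (j + 1) x) (headProj l x)
        = s (j + 1) - s j := by
    intro j hj
    have hj := Finset.mem_range.1 hj
    rw [real_inner_smul_left, inner_headProj, min_eq_left (by omega), mul_assoc,
      inv_mul_cancel₀ (partialNormSq_pos j.succ_pos hx).ne', mul_one]
  rw [drift, sum_inner, Finset.sum_congr rfl h, Finset.sum_range_sub, hs, sub_zero]

/-- Adding the term of index m + 1 contributes its square and a cross term 2 s_m (s_{m+1} - s_m),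
which together make s_{m+1}² - s_m². -/
theorem norm_drift_sq {s : ℕ → ℝ} (hs : s 0 = 0) (m : ℕ)
    {x : EuclideanSpace ℝ (Fin n)} (hx : x ∈ halfSpace n) :
    ‖drift s m x‖ ^ 2
      = ∑ j ∈ Finset.range m, (s (j + 1) ^ 2 - s j ^ 2) * (partialNormSq (j + 1) x)⁻¹ := by
  induction m with
  | zero => simp [drift]
  | succ m ih =>
    have hN := partialNormSq_pos m.succ_pos hx
    rw [Finset.sum_range_succ, ← ih, drift, Finset.sum_range_succ, ← drift, norm_add_sq_real,
      real_inner_smul_right, inner_drift_headProj hs m.le_succ hx, norm_smul, mul_pow,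
      norm_headProj_sq, Real.norm_eq_abs, sq_abs]
    field_simp
    ring

theorem IsTestFunction.contDiff_sq {u : EuclideanSpace ℝ (Fin n) → ℝ}
    (hu : IsTestFunction (halfSpace n) u) :
    ContDiff ℝ 1 fun x => u x ^ 2 :=
  (hu.smooth.of_le (by norm_cast)).pow 2

theorem IsTestFunction.tsupport_sq {u : EuclideanSpace ℝ (Fin n) → ℝ}
    (hu : IsTestFunction (halfSpace n) u) : tsupport (fun x => u x ^ 2) ⊆ halfSpace n :=
  (tsupport_comp_subset (g := fun t : ℝ => t ^ 2) (by simp) u).trans hu.support_subset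

theorem IsTestFunction.hasCompactSupport_sq {u : EuclideanSpace ℝ (Fin n) → ℝ}
    (hu : IsTestFunction (halfSpace n) u) : HasCompactSupport (fun x => u x ^ 2) :=
  hu.compactSupport.comp_left (g := fun t : ℝ => t ^ 2) (by simp)

theorem IsTestFunction.contDiff_one {u : EuclideanSpace ℝ (Fin n) → ℝ}
    (hu : IsTestFunction (halfSpace n) u) : ContDiff ℝ 1 u :=
  hu.smooth.of_le (by norm_cast)

theorem IsTestFunction.continuous_gradient {u : EuclideanSpace ℝ (Fin n) → ℝ}
    (hu : IsTestFunction (halfSpace n) u) : Continuous (gradient u) :=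
  (InnerProductSpace.toDual ℝ _).symm.continuous.comp
    (hu.contDiff_one.continuous_fderiv (by norm_num))

theorem tsupport_gradient_subset (u : EuclideanSpace ℝ (Fin n) → ℝ) :
    tsupport (gradient u) ⊆ tsupport u := by
  refine (tsupport_comp_subset (g := (InnerProductSpace.toDual ℝ (EuclideanSpace ℝ (Fin n))).symm)
    (by simp) (fderiv ℝ u)).trans (tsupport_fderiv_subset ℝ)

theorem gradient_eq_zero_of_notMem {u : EuclideanSpace ℝ (Fin n) → ℝ}
    (hu : IsTestFunction (halfSpace n) u) {x : EuclideanSpace ℝ (Fin n)} (hx : x ∉ halfSpace n) :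
    gradient u x = 0 :=
  image_eq_zero_of_notMem_tsupport fun h => hx (hu.support_subset (tsupport_gradient_subset u h))

theorem IsTestFunction.eq_zero {u : EuclideanSpace ℝ (Fin n) → ℝ}
    (hu : IsTestFunction (halfSpace n) u) {x : EuclideanSpace ℝ (Fin n)} (hx : x ∉ halfSpace n) :
    u x = 0 :=
  image_eq_zero_of_notMem_tsupport fun h => hx (hu.support_subset h)

theorem integrable_norm_gradient_sq {u : EuclideanSpace ℝ (Fin n) → ℝ}
    (hu : IsTestFunction (halfSpace n) u) : Integrable fun x => ‖gradient u x‖ ^ 2 := by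
  refine (hu.continuous_gradient.norm.pow 2).integrable_of_hasCompactSupport
    (hu.compactSupport.mono' fun x hx => ?_)
  by_contra h
  have : gradient u x = 0 := image_eq_zero_of_notMem_tsupport fun h' =>
    h (tsupport_gradient_subset u h')
  simp [this] at hx

theorem integrable_inv_partialNormSq_mul_sq {u : EuclideanSpace ℝ (Fin n) → ℝ}
    (hu : IsTestFunction (halfSpace n) u) {j : ℕ} (hj : 0 < j) :
    Integrable fun x => (partialNormSq j x)⁻¹ * u x ^ 2 := by
  refine integrable_mul_of_tsupport ?_ (hu.contDiff_one.continuous.pow 2) hu.hasCompactSupport_sq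
    hu.tsupport_sq
  exact (continuous_partialNormSq j).continuousOn.inv₀ fun x hx => (partialNormSq_pos hj hx).ne'

/-- In the expanded square the cross term 2u∇u is written as ∇(u²), ready for integration by parts.
-/
theorem norm_gradient_sub_drift_sq {s : ℕ → ℝ} (hs : s 0 = 0)
    {u : EuclideanSpace ℝ (Fin n) → ℝ} (hu : IsTestFunction (halfSpace n) u)
    (x : EuclideanSpace ℝ (Fin n)) :
    ‖gradient u x - u x • drift s n x‖ ^ 2 = ‖gradient u x‖ ^ 2
      - ∑ j ∈ Finset.range n, (s (j + 1) - s j) *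
          ((partialNormSq (j + 1) x)⁻¹ * fderiv ℝ (fun y => u y ^ 2) x (headProj (j + 1) x))
      + ∑ j ∈ Finset.range n, (s (j + 1) ^ 2 - s j ^ 2) *
          ((partialNormSq (j + 1) x)⁻¹ * u x ^ 2) := by
  have hd : fderiv ℝ (fun y => u y ^ 2) x = (2 * u x) • fderiv ℝ u x := by
    have := ((hu.contDiff_one.differentiable (by norm_num) x).hasFDerivAt.pow 2).fderiv
    simpa using this
  by_cases hx : x ∈ halfSpace n
  · rw [norm_sub_sq_real, norm_smul, mul_pow, norm_drift_sq hs n hx, real_inner_smul_right,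
      Real.norm_eq_abs, sq_abs, hd, drift, inner_sum, Finset.mul_sum, Finset.mul_sum,
      Finset.mul_sum]
    congr 1
    · congr 1
      refine Finset.sum_congr rfl fun j _ => ?_
      rw [real_inner_smul_right, inner_gradient_left]
      simp
      ring
    · exact Finset.sum_congr rfl fun j _ => by ring
  · simp [gradient_eq_zero_of_notMem hu hx, hu.eq_zero hx, hd]

theorem integrable_inv_mul_fderiv_sq {u : EuclideanSpace ℝ (Fin n) → ℝ}
    (hu : IsTestFunction (halfSpace n) u) {j : ℕ} (hj : 0 < j) :
    Integrable fun x =>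
      (partialNormSq j x)⁻¹ * fderiv ℝ (fun y => u y ^ 2) x (headProj j x) := by
  refine integrable_mul_of_tsupport ?_ (continuous_fderiv_headProj hu.contDiff_sq j)
    (hu.hasCompactSupport_sq.of_isClosed_subset (isClosed_tsupport _)
      (tsupport_fderiv_headProj _ j)) ((tsupport_fderiv_headProj _ j).trans hu.tsupport_sq)
  exact (continuous_partialNormSq j).continuousOn.inv₀ fun x hx => (partialNormSq_pos hj hx).ne'

/-- The ground state representation of the energy. -/
theorem energy_identity {s : ℕ → ℝ} (hs : s 0 = 0)
    {u : EuclideanSpace ℝ (Fin n) → ℝ} (hu : IsTestFunction (halfSpace n) u) :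
    Integrable (fun x => ‖gradient u x - u x • drift s n x‖ ^ 2) ∧
    ∫ x, ‖gradient u x - u x • drift s n x‖ ^ 2 = (∫ x, ‖gradient u x‖ ^ 2)
      + ∑ j ∈ Finset.range n, driftCoeff s j * ∫ x, (partialNormSq (j + 1) x)⁻¹ * u x ^ 2 := by
  have h1 := integrable_norm_gradient_sq hu
  have h2 : ∀ j ∈ Finset.range n, Integrable fun x => (s (j + 1) - s j) *
      ((partialNormSq (j + 1) x)⁻¹ * fderiv ℝ (fun y => u y ^ 2) x (headProj (j + 1) x)) :=
    fun j _ => (integrable_inv_mul_fderiv_sq hu j.succ_pos).const_mul _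
  have h3 : ∀ j ∈ Finset.range n, Integrable fun x => (s (j + 1) ^ 2 - s j ^ 2) *
      ((partialNormSq (j + 1) x)⁻¹ * u x ^ 2) :=
    fun j _ => (integrable_inv_partialNormSq_mul_sq hu j.succ_pos).const_mul _
  have e := funext (norm_gradient_sub_drift_sq hs hu)
  rw [e]
  refine ⟨(h1.sub (integrable_finsetSum _ h2)).add (integrable_finsetSum _ h3), ?_⟩
  have h12 : Integrable fun x => ‖gradient u x‖ ^ 2 - ∑ j ∈ Finset.range n, (s (j + 1) - s j) *
      ((partialNormSq (j + 1) x)⁻¹ * fderiv ℝ (fun y => u y ^ 2) x (headProj (j + 1) x)) :=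
    h1.sub (integrable_finsetSum _ h2)
  rw [integral_add h12 (integrable_finsetSum _ h3), integral_sub h1 (integrable_finsetSum _ h2), integral_finsetSum _ h2, integral_finsetSum _ h3,
    sub_add, sub_eq_add_neg, ← Finset.sum_sub_distrib, ← Finset.sum_neg_distrib]
  congr 1
  refine Finset.sum_congr rfl fun j hj => ?_
  -- The exponent -1 encodes div(X_{j+1}/|X_{j+1}|²) = (j - 1)/|X_{j+1}|².
  have hL := integral_fderiv_headProj_mul_rpow hu.contDiff_sq hu.hasCompactSupport_sq
    hu.tsupport_sq j.succ_pos (Finset.mem_range.1 hj) (-1)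
  simp only [Real.rpow_neg_one, Nat.succ_eq_add_one] at hL
  rw [integral_const_mul, integral_const_mul, hL, driftCoeff]
  push_cast
  ring

/-! ### The Sobolev inequality for the ground state energy -/

theorem continuousOn_drift (s : ℕ → ℝ) (m : ℕ) :
    ContinuousOn (drift s m : EuclideanSpace ℝ (Fin n) → EuclideanSpace ℝ (Fin n))
      (halfSpace n) := by
  unfold drift
  refine continuousOn_finsetSum _ fun j _ =>
    ContinuousOn.fun_smul ?_ (continuous_headProj _).continuousOn
  exact continuousOn_const.mul ((continuous_partialNormSq _).continuousOn.inv₀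
    fun x hx => (partialNormSq_pos j.succ_pos hx).ne')

theorem IsTestFunction.continuous_gradient_sub_drift {u : EuclideanSpace ℝ (Fin n) → ℝ}
    (hu : IsTestFunction (halfSpace n) u) (s : ℕ → ℝ) :
    Continuous fun x => gradient u x - u x • drift s n x := by
  refine hu.continuous_gradient.sub ?_
  refine (hu.contDiff_one.continuous.continuousOn.smul
    (continuousOn_drift s n)).continuous_of_tsupport_subset isOpen_halfSpace ?_
  exact (tsupport_smul_subset_left u (drift s n)).trans hu.support_subset

theorem IsTestFunction.hasCompactSupport_gradient_sub_drift {u : EuclideanSpace ℝ (Fin n) → ℝ}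
    (hu : IsTestFunction (halfSpace n) u) (s : ℕ → ℝ) :
    HasCompactSupport fun x => gradient u x - u x • drift s n x := by
  refine hu.compactSupport.mono' fun x hx => ?_
  by_contra h
  have h1 : gradient u x = 0 := image_eq_zero_of_notMem_tsupport fun h' =>
    h (tsupport_gradient_subset u h')
  have h2 : u x = 0 := image_eq_zero_of_notMem_tsupport h
  simp [h1, h2] at hx

theorem IsTestFunction.contDiff_abs_rpow {u : EuclideanSpace ℝ (Fin n) → ℝ}
    (hu : IsTestFunction (halfSpace n) u) {q : ℝ} (hq : 1 < q) :
    ContDiff ℝ 1 fun x => |u x| ^ q :=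
  (contDiff_norm_rpow (E := ℝ) hq).comp hu.contDiff_one

theorem IsTestFunction.hasCompactSupport_abs_rpow {u : EuclideanSpace ℝ (Fin n) → ℝ}
    (hu : IsTestFunction (halfSpace n) u) {q : ℝ} (hq : 0 < q) :
    HasCompactSupport fun x => |u x| ^ q :=
  hu.compactSupport.comp_left (g := fun t : ℝ => |t| ^ q) (by simp [hq.ne'])

theorem IsTestFunction.tsupport_abs_rpow {u : EuclideanSpace ℝ (Fin n) → ℝ}
    (hu : IsTestFunction (halfSpace n) u) {q : ℝ} (hq : 0 < q) :
    tsupport (fun x => |u x| ^ q) ⊆ halfSpace n :=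
  (tsupport_comp_subset (g := fun t : ℝ => |t| ^ q) (by simp [hq.ne']) u).trans hu.support_subset

theorem IsTestFunction.continuous_abs_rpow {u : EuclideanSpace ℝ (Fin n) → ℝ}
    (hu : IsTestFunction (halfSpace n) u) {q : ℝ} (hq : 0 < q) :
    Continuous fun x => |u x| ^ q :=
  hu.contDiff_one.continuous.abs.rpow_const fun _ => Or.inr hq.le

theorem IsTestFunction.fderiv_abs_rpow {u : EuclideanSpace ℝ (Fin n) → ℝ}
    (hu : IsTestFunction (halfSpace n) u) {q : ℝ} (hq : 1 < q) (x : EuclideanSpace ℝ (Fin n)) :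
    fderiv ℝ (fun y => |u y| ^ q) x = (q * |u x| ^ (q - 2) * u x) • fderiv ℝ u x :=
  ((hasDerivAt_abs_rpow (u x) hq).comp_hasFDerivAt x
    (hu.contDiff_one.differentiable (by norm_num) x).hasFDerivAt).fderiv

theorem abs_rpow_sub_two_mul {q : ℝ} (hq : 1 < q) (t : ℝ) :
    |(|t| ^ (q - 2) * t)| = |t| ^ (q - 1) := by
  rcases eq_or_ne t 0 with rfl | ht
  · simp [Real.zero_rpow (by linarith : q - 1 ≠ 0)]
  · rw [abs_mul, abs_of_nonneg (by positivity), show q - 1 = (q - 2) + 1 by ring,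
      Real.rpow_add_one (abs_pos.2 ht).ne']

theorem abs_rpow_sub_two_mul_sq {q : ℝ} (hq : 1 < q) (t : ℝ) :
    |t| ^ (q - 2) * t * t = |t| ^ q := by
  rcases eq_or_ne t 0 with rfl | ht
  · simp [Real.zero_rpow (by linarith : q ≠ 0)]
  · rw [mul_assoc, ← abs_mul_abs_self, show |t| ^ q = |t| ^ ((q - 2) + 1 + 1) by ring_nf,
      Real.rpow_add_one (abs_pos.2 ht).ne', Real.rpow_add_one (abs_pos.2 ht).ne']
    ring

theorem integrable_abs_rpow_mul {u : EuclideanSpace ℝ (Fin n) → ℝ}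
    (hu : IsTestFunction (halfSpace n) u) {q : ℝ} (hq : 0 < q) {j : ℕ} (hj : 0 < j) (α : ℝ) :
    Integrable fun x => partialNormSq j x ^ α * |u x| ^ q :=
  integrable_mul_of_tsupport (continuousOn_partialNormSq_rpow hj α) (hu.continuous_abs_rpow hq)
    (hu.hasCompactSupport_abs_rpow hq) (hu.tsupport_abs_rpow hq)

theorem integrable_abs_rpow_mul_norm {u : EuclideanSpace ℝ (Fin n) → ℝ}
    (hu : IsTestFunction (halfSpace n) u) {q : ℝ} (hq : 0 < q) (s : ℕ → ℝ) :
    Integrable fun x => |u x| ^ q * ‖gradient u x - u x • drift s n x‖ :=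
  ((hu.continuous_abs_rpow hq).mul
    (hu.continuous_gradient_sub_drift s).norm).integrable_of_hasCompactSupport
      (hu.hasCompactSupport_abs_rpow hq).mul_right

/-- The drift terms up to index j + 1 contribute exactly s_{j+1}. A later term carries
|X_{j+1}|/|X_{i+1}|² ≤ 1/|X_{i+1}|, so it only costs a weaker weight. -/
theorem le_inner_drift_mul_rpow {s : ℕ → ℝ} (hs : s 0 = 0) {A : ℝ}
    (hA : ∀ i < n, |s (i + 1) - s i| ≤ A) {j : ℕ} (hj : j < n)
    {x : EuclideanSpace ℝ (Fin n)} (hx : x ∈ halfSpace n) :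
    s (j + 1) * partialNormSq (j + 1) x ^ (-1 / 2 : ℝ)
        - A * ∑ i ∈ Finset.Ico (j + 1) n, partialNormSq (i + 1) x ^ (-1 / 2 : ℝ)
      ≤ partialNormSq (j + 1) x ^ (-1 / 2 : ℝ) * inner ℝ (drift s n x) (headProj (j + 1) x) := by
  have hsplit : drift s n x = drift s (j + 1) x + ∑ i ∈ Finset.Ico (j + 1) n,
      ((s (i + 1) - s i) * (partialNormSq (i + 1) x)⁻¹) • headProj (i + 1) x := by
    rw [drift, drift, Finset.sum_range_add_sum_Ico _ (by omega)]
  rw [hsplit, inner_add_left, inner_drift_headProj hs le_rfl hx, mul_add, sum_inner,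
    Finset.mul_sum, Finset.mul_sum, mul_comm, sub_eq_add_neg, ← Finset.sum_neg_distrib]
  refine add_le_add le_rfl (Finset.sum_le_sum fun i hi => ?_)
  obtain ⟨hi1, hi2⟩ := Finset.mem_Ico.1 hi
  have hNi := partialNormSq_pos i.succ_pos hx
  have hNj := partialNormSq_pos j.succ_pos hx
  have hle := partialNormSq_mono (show j + 1 ≤ i + 1 by omega) x
  rw [real_inner_smul_left, inner_headProj, min_eq_right (by omega)]
  simp only [Nat.succ_eq_add_one] at hNi hNj
  set a := partialNormSq (j + 1) x
  set b := partialNormSq (i + 1) x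
  have h1 : a ^ (-1 / 2 : ℝ) * (b⁻¹ * a) ≤ b ^ (-1 / 2 : ℝ) := by
    have e1 : a ^ (-1 / 2 : ℝ) * a = a ^ (1 / 2 : ℝ) := by
      rw [← Real.rpow_add_one hNj.ne']; norm_num
    have e2 : b⁻¹ * b ^ (1 / 2 : ℝ) = b ^ (-1 / 2 : ℝ) := by
      rw [← Real.rpow_neg_one, ← Real.rpow_add hNi]; norm_num
    calc a ^ (-1 / 2 : ℝ) * (b⁻¹ * a) = b⁻¹ * (a ^ (-1 / 2 : ℝ) * a) := by ring
      _ ≤ b⁻¹ * b ^ (1 / 2 : ℝ) := by rw [e1]; gcongr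
      _ = _ := e2
  have h0 : 0 ≤ a ^ (-1 / 2 : ℝ) * (b⁻¹ * a) := by positivity
  have h2 := abs_le.1 (hA i hi2)
  have h3 : -(A * (a ^ (-1 / 2 : ℝ) * (b⁻¹ * a))) ≤
      (s (i + 1) - s i) * (a ^ (-1 / 2 : ℝ) * (b⁻¹ * a)) := by nlinarith
  have h4 : A * (a ^ (-1 / 2 : ℝ) * (b⁻¹ * a)) ≤ A * b ^ (-1 / 2 : ℝ) :=
    mul_le_mul_of_nonneg_left h1 ((abs_nonneg _).trans (hA i hi2))
  calc _ ≤ (s (i + 1) - s i) * (a ^ (-1 / 2 : ℝ) * (b⁻¹ * a)) := by linarith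
    _ = _ := by ring

/-- One step of the weighted `L¹` Hardy inequality. -/
theorem weighted_hardy_step {s : ℕ → ℝ} (hs : s 0 = 0) {A : ℝ}
    (hA : ∀ i < n, |s (i + 1) - s i| ≤ A) {q : ℝ} (hq : 1 < q) {j : ℕ} (hj : j < n)
    {u : EuclideanSpace ℝ (Fin n) → ℝ} (hu : IsTestFunction (halfSpace n) u) :
    (q * s (j + 1) + j) * ∫ x, partialNormSq (j + 1) x ^ (-1 / 2 : ℝ) * |u x| ^ q
      ≤ q * (∫ x, |u x| ^ (q - 1) * ‖gradient u x - u x • drift s n x‖)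
        + q * A * ∑ i ∈ Finset.Ico (j + 1) n,
            ∫ x, partialNormSq (i + 1) x ^ (-1 / 2 : ℝ) * |u x| ^ q := by
  have hq0 : 0 < q := by linarith
  -- The test field is X_{j+1}/|X_{j+1}|, of norm one and divergence j/|X_{j+1}|.
  have hL := integral_fderiv_headProj_mul_rpow (hu.contDiff_abs_rpow hq)
    (hu.hasCompactSupport_abs_rpow hq0) (hu.tsupport_abs_rpow hq0) j.succ_pos hj (-1 / 2)
  simp only [Nat.succ_eq_add_one] at hL
  have i1 := (integrable_abs_rpow_mul_norm hu (by linarith : 0 < q - 1) s).const_mul q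
  have i2 := (integrable_abs_rpow_mul hu hq0 j.succ_pos (-1 / 2)).const_mul (q * s (j + 1))
  have i3 : ∀ i ∈ Finset.Ico (j + 1) n, Integrable fun x =>
      partialNormSq (i + 1) x ^ (-1 / 2 : ℝ) * |u x| ^ q :=
    fun i _ => integrable_abs_rpow_mul hu hq0 i.succ_pos (-1 / 2)
  have i4 := (integrable_finsetSum _ i3).const_mul (q * A)
  have i5 : Integrable fun x => partialNormSq (j + 1) x ^ (-1 / 2 : ℝ) *
      fderiv ℝ (fun y => |u y| ^ q) x (headProj (j + 1) x) :=
    integrable_mul_of_tsupport (continuousOn_partialNormSq_rpow j.succ_pos _)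
      (continuous_fderiv_headProj (hu.contDiff_abs_rpow hq) _)
      ((hu.hasCompactSupport_abs_rpow hq0).of_isClosed_subset (isClosed_tsupport _)
        (tsupport_fderiv_headProj _ _))
      ((tsupport_fderiv_headProj _ _).trans (hu.tsupport_abs_rpow hq0))
  have hpt : ∀ x, q * s (j + 1) * (partialNormSq (j + 1) x ^ (-1 / 2 : ℝ) * |u x| ^ q)
      - q * A * ∑ i ∈ Finset.Ico (j + 1) n, partialNormSq (i + 1) x ^ (-1 / 2 : ℝ) * |u x| ^ q
      - q * (|u x| ^ (q - 1) * ‖gradient u x - u x • drift s n x‖)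
      ≤ partialNormSq (j + 1) x ^ (-1 / 2 : ℝ) *
        fderiv ℝ (fun y => |u y| ^ q) x (headProj (j + 1) x) := by
    intro x
    by_cases hx : x ∈ halfSpace n
    · have hN := partialNormSq_pos j.succ_pos hx
      have h1 := le_inner_drift_mul_rpow hs hA hj hx
      set W := gradient u x - u x • drift s n x with hW
      have h2 : fderiv ℝ u x (headProj (j + 1) x) = inner ℝ W (headProj (j + 1) x)
          + u x * inner ℝ (drift s n x) (headProj (j + 1) x) := by
        rw [hW, inner_sub_left, real_inner_smul_left, inner_gradient_left]; ring
      have h3 : partialNormSq (j + 1) x ^ (-1 / 2 : ℝ) * |inner ℝ W (headProj (j + 1) x)|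
          ≤ ‖W‖ := by
        have := abs_real_inner_le_norm W (headProj (j + 1) x)
        rw [norm_headProj, Real.sqrt_eq_rpow] at this
        calc _ ≤ partialNormSq (j + 1) x ^ (-1 / 2 : ℝ) *
              (‖W‖ * partialNormSq (j + 1) x ^ (1 / 2 : ℝ)) := by gcongr
          _ = ‖W‖ * (partialNormSq (j + 1) x ^ (-1 / 2 : ℝ) *
                partialNormSq (j + 1) x ^ (1 / 2 : ℝ)) := by ring
          _ = ‖W‖ := by rw [← Real.rpow_add hN]; norm_num
      have h4 : -(|u x| ^ (q - 1) * ‖W‖) ≤ (|u x| ^ (q - 2) * u x) *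
          (partialNormSq (j + 1) x ^ (-1 / 2 : ℝ) * inner ℝ W (headProj (j + 1) x)) := by
        refine (neg_le_neg ?_).trans (neg_abs_le _)
        rw [abs_mul, abs_rpow_sub_two_mul hq, abs_mul, abs_of_pos (Real.rpow_pos_of_pos hN _)]
        gcongr
      have h5 := mul_le_mul_of_nonneg_left h1 (Real.rpow_nonneg (abs_nonneg (u x)) q)
      rw [hu.fderiv_abs_rpow hq, smul_apply, h2, smul_eq_mul,
        ← Finset.sum_mul]
      have h6 := abs_rpow_sub_two_mul_sq hq (u x)
      have h7 : partialNormSq (j + 1) x ^ (-1 / 2 : ℝ) * (q * |u x| ^ (q - 2) * u x *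
          (inner ℝ W (headProj (j + 1) x) + u x * inner ℝ (drift s n x) (headProj (j + 1) x)))
          = q * ((|u x| ^ (q - 2) * u x) * (partialNormSq (j + 1) x ^ (-1 / 2 : ℝ) *
              inner ℝ W (headProj (j + 1) x)))
            + q * (|u x| ^ q * (partialNormSq (j + 1) x ^ (-1 / 2 : ℝ) *
              inner ℝ (drift s n x) (headProj (j + 1) x))) := by
        rw [← h6]; ring
      rw [h7]
      nlinarith [mul_le_mul_of_nonneg_left h4 hq0.le, mul_le_mul_of_nonneg_left h5 hq0.le]
    · have h0 : u x = 0 := hu.eq_zero hx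
      simp [hu.fderiv_abs_rpow hq, h0, Real.zero_rpow hq0.ne',
        Real.zero_rpow (by linarith : q - 1 ≠ 0)]
  have hint := integral_mono ((i2.sub i4).sub i1) i5 hpt
  have e : ∫ x, (((fun x => q * s (j + 1) * (partialNormSq (j + 1) x ^ (-1 / 2 : ℝ) * |u x| ^ q))
      - fun x => q * A * ∑ i ∈ Finset.Ico (j + 1) n,
          partialNormSq (i + 1) x ^ (-1 / 2 : ℝ) * |u x| ^ q)
      - fun x => q * (|u x| ^ (q - 1) * ‖gradient u x - u x • drift s n x‖)) x
      = q * s (j + 1) * (∫ x, partialNormSq (j + 1) x ^ (-1 / 2 : ℝ) * |u x| ^ q)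
        - q * A * (∑ i ∈ Finset.Ico (j + 1) n,
            ∫ x, partialNormSq (i + 1) x ^ (-1 / 2 : ℝ) * |u x| ^ q)
        - q * ∫ x, |u x| ^ (q - 1) * ‖gradient u x - u x • drift s n x‖ := by
    rw [integral_sub' (i2.sub i4) i1, integral_sub' i2 i4, integral_const_mul, integral_const_mul,
      integral_const_mul, integral_finsetSum _ i3]
  rw [hL] at hint
  have hint' := e.symm.le.trans hint
  push_cast at hint'
  linarith

/-- Downward induction on the index: `weighted_hardy_step` bounds each weight by the strictly later,
already controlled ones. For the last weight there is nothing left to control. -/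
theorem weighted_hardy {s : ℕ → ℝ} (hs : s 0 = 0) {q : ℝ} (hq : 1 < q)
    (hpos : ∀ j < n, 0 < q * s (j + 1) + j) :
    ∃ K : ℝ, 0 ≤ K ∧ ∀ u : EuclideanSpace ℝ (Fin n) → ℝ, IsTestFunction (halfSpace n) u →
      ∀ j < n, ∫ x, partialNormSq (j + 1) x ^ (-1 / 2 : ℝ) * |u x| ^ q
        ≤ K * ∫ x, |u x| ^ (q - 1) * ‖gradient u x - u x • drift s n x‖ := by
  obtain ⟨A, hA⟩ : ∃ A : ℝ, ∀ i < n, |s (i + 1) - s i| ≤ A :=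
    ⟨∑ i ∈ Finset.range n, |s (i + 1) - s i|, fun i hi =>
      Finset.single_le_sum (f := fun i => |s (i + 1) - s i|) (fun _ _ => abs_nonneg _)
        (Finset.mem_range.2 hi)⟩
  have hA0 : 0 ≤ |A| := abs_nonneg A
  replace hA : ∀ i < n, |s (i + 1) - s i| ≤ |A| := fun i hi => (hA i hi).trans (le_abs_self A)
  have main : ∀ m : ℕ, ∃ K : ℝ, 0 ≤ K ∧ ∀ u : EuclideanSpace ℝ (Fin n) → ℝ,
      IsTestFunction (halfSpace n) u → ∀ j < n, n ≤ j + m →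
        ∫ x, partialNormSq (j + 1) x ^ (-1 / 2 : ℝ) * |u x| ^ q
        ≤ K * ∫ x, |u x| ^ (q - 1) * ‖gradient u x - u x • drift s n x‖ := by
    intro m
    induction m with
    | zero => exact ⟨0, le_rfl, fun u _ j hj h => by omega⟩
    | succ m ih =>
      obtain ⟨K, hK, h⟩ := ih
      by_cases hm : m < n
      swap
      · exact ⟨K, hK, fun u hu j hj _ => h u hu j hj (by omega)⟩
      set j₀ := n - 1 - m with hj₀
      have hj₀n : j₀ < n := by omega
      have hκ := hpos j₀ hj₀n
      -- The quotient comes from the step at `j₀`, with at most n later integrals each bounded by K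
      -- times the right-hand integral; adding K keeps the bound valid for the later indices.
      refine ⟨K + (q + q * |A| * (n * K)) / (q * s (j₀ + 1) + j₀), by positivity,
        fun u hu j hj hjm => ?_⟩
      have hD : 0 ≤ ∫ x, |u x| ^ (q - 1) * ‖gradient u x - u x • drift s n x‖ :=
        integral_nonneg fun x => by positivity
      set D := ∫ x, |u x| ^ (q - 1) * ‖gradient u x - u x • drift s n x‖ with hDdef
      have hquot : 0 ≤ (q + q * |A| * (n * K)) / (q * s (j₀ + 1) + j₀) := by positivity
      by_cases hjm' : n ≤ j + m
      · refine (h u hu j hj hjm').trans (mul_le_mul_of_nonneg_right ?_ hD)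
        linarith
      · have hjj : j = j₀ := by omega
        rw [← hjj] at hκ hquot ⊢
        have hstep := weighted_hardy_step hs hA hq hj hu
        have hsum : ∑ i ∈ Finset.Ico (j + 1) n,
            ∫ x, partialNormSq (i + 1) x ^ (-1 / 2 : ℝ) * |u x| ^ q ≤ n * (K * D) := by
          calc _ ≤ ∑ _i ∈ Finset.Ico (j + 1) n, K * D := by
                refine Finset.sum_le_sum fun i hi => ?_
                obtain ⟨h1, h2⟩ := Finset.mem_Ico.1 hi
                exact h u hu i h2 (by omega)
            _ = ((n - (j + 1) : ℕ) : ℝ) * (K * D) := by simp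
            _ ≤ _ := by
                gcongr
                omega
        have hb : (q * s (j + 1) + j) * ∫ x, partialNormSq (j + 1) x ^ (-1 / 2 : ℝ) * |u x| ^ q
            ≤ (q + q * |A| * (n * K)) * D := by
          have := mul_le_mul_of_nonneg_left hsum (show 0 ≤ q * |A| by positivity)
          linarith
        calc _ ≤ (q + q * |A| * (n * K)) * D / (q * s (j + 1) + j) := by
              rw [le_div_iff₀ hκ]; linarith
          _ = (q + q * |A| * (n * K)) / (q * s (j + 1) + j) * D := by ring
          _ ≤ _ := by
              rw [add_mul]
              linarith [mul_nonneg hK hD]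
  obtain ⟨K, hK, h⟩ := main n
  exact ⟨K, hK, fun u hu j hj => h u hu j hj (by omega)⟩

theorem norm_drift_le {s : ℕ → ℝ} {x : EuclideanSpace ℝ (Fin n)} (hx : x ∈ halfSpace n) :
    ‖drift s n x‖ ≤ ∑ j ∈ Finset.range n,
      |s (j + 1) - s j| * partialNormSq (j + 1) x ^ (-1 / 2 : ℝ) := by
  refine (norm_sum_le _ _).trans (Finset.sum_le_sum fun j _ => ?_)
  have hN := partialNormSq_pos j.succ_pos hx
  simp only [Nat.succ_eq_add_one] at hN
  rw [norm_smul, norm_mul, norm_headProj, Real.norm_eq_abs, Real.norm_eq_abs, mul_assoc,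
    abs_of_pos (inv_pos.2 hN), Real.sqrt_eq_rpow, ← Real.rpow_neg_one, ← Real.rpow_add hN]
  norm_num

/-- Writing ∇u = W + u · drift, the drift part of ∇|u|^q is at most a combination of the
|u|^q/|X_j|, which `weighted_hardy` absorbs into the W part. -/
theorem integral_norm_fderiv_abs_rpow_le {s : ℕ → ℝ} (hs : s 0 = 0) {q : ℝ} (hq : 1 < q)
    (hpos : ∀ j < n, 0 < q * s (j + 1) + j) :
    ∃ K : ℝ, 0 ≤ K ∧ ∀ u : EuclideanSpace ℝ (Fin n) → ℝ, IsTestFunction (halfSpace n) u →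
      ∫ x, ‖fderiv ℝ (fun y => |u y| ^ q) x‖
        ≤ K * ∫ x, |u x| ^ (q - 1) * ‖gradient u x - u x • drift s n x‖ := by
  obtain ⟨K, hK, h⟩ := weighted_hardy (n := n) hs hq hpos
  have hq0 : 0 < q := by linarith
  refine ⟨q + q * ∑ j ∈ Finset.range n, |s (j + 1) - s j| * K, ?_, fun u hu => ?_⟩
  · have : 0 ≤ ∑ j ∈ Finset.range n, |s (j + 1) - s j| * K :=
      Finset.sum_nonneg fun _ _ => by positivity
    positivity
  have i1 := (integrable_abs_rpow_mul_norm hu (by linarith : 0 < q - 1) s).const_mul q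
  have i2 : ∀ j ∈ Finset.range n, Integrable fun x => |s (j + 1) - s j| *
      (partialNormSq (j + 1) x ^ (-1 / 2 : ℝ) * |u x| ^ q) :=
    fun j _ => (integrable_abs_rpow_mul hu hq0 j.succ_pos (-1 / 2)).const_mul _
  have i3 := (integrable_finsetSum _ i2).const_mul q
  have hcont : Continuous fun x => fderiv ℝ (fun y => |u y| ^ q) x :=
    (hu.contDiff_abs_rpow hq).continuous_fderiv (by norm_num)
  have i4 : Integrable fun x => ‖fderiv ℝ (fun y => |u y| ^ q) x‖ :=
    hcont.norm.integrable_of_hasCompactSupport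
      ((hu.hasCompactSupport_abs_rpow hq0).fderiv (𝕜 := ℝ)).norm
  have hpt : ∀ x, ‖fderiv ℝ (fun y => |u y| ^ q) x‖ ≤
      q * (|u x| ^ (q - 1) * ‖gradient u x - u x • drift s n x‖)
      + q * ∑ j ∈ Finset.range n, |s (j + 1) - s j| *
          (partialNormSq (j + 1) x ^ (-1 / 2 : ℝ) * |u x| ^ q) := by
    intro x
    by_cases hx : x ∈ halfSpace n
    · have e1 : ‖fderiv ℝ u x‖ = ‖gradient u x‖ := by
        rw [← toDual_gradient, LinearIsometryEquiv.norm_map]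
      have e2 : ‖gradient u x‖ ≤ ‖gradient u x - u x • drift s n x‖ +
          |u x| * ∑ j ∈ Finset.range n,
            |s (j + 1) - s j| * partialNormSq (j + 1) x ^ (-1 / 2 : ℝ) := by
        calc ‖gradient u x‖ = ‖(gradient u x - u x • drift s n x) + u x • drift s n x‖ := by
              rw [sub_add_cancel]
          _ ≤ _ := norm_add_le _ _
          _ ≤ _ := by
              rw [norm_smul, Real.norm_eq_abs]
              have := norm_drift_le (s := s) hx
              gcongr
      have e3 : |u x| ^ (q - 1) * |u x| = |u x| ^ q := by
        rw [← abs_rpow_sub_two_mul hq, ← abs_mul, abs_rpow_sub_two_mul_sq hq,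
          abs_of_nonneg (by positivity)]
      rw [hu.fderiv_abs_rpow hq, norm_smul, e1, mul_assoc, norm_mul, Real.norm_eq_abs,
        Real.norm_eq_abs, abs_rpow_sub_two_mul hq, abs_of_pos hq0]
      calc q * |u x| ^ (q - 1) * ‖gradient u x‖ ≤ q * |u x| ^ (q - 1) *
            (‖gradient u x - u x • drift s n x‖ + |u x| * ∑ j ∈ Finset.range n,
            |s (j + 1) - s j| * partialNormSq (j + 1) x ^ (-1 / 2 : ℝ)) := by gcongr
        _ = q * (|u x| ^ (q - 1) * ‖gradient u x - u x • drift s n x‖)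
            + q * ((|u x| ^ (q - 1) * |u x|) * ∑ j ∈ Finset.range n,
            |s (j + 1) - s j| * partialNormSq (j + 1) x ^ (-1 / 2 : ℝ)) := by ring
        _ = _ := by
            rw [e3, Finset.mul_sum]
            congr 2
            exact Finset.sum_congr rfl fun j _ => by ring
    · have h0 : u x = 0 := hu.eq_zero hx
      simp [hu.fderiv_abs_rpow hq, h0, Real.zero_rpow hq0.ne',
        Real.zero_rpow (by linarith : q - 1 ≠ 0)]
  have hint := integral_mono i4 (i1.add i3) hpt
  have e := integral_add' i1 i3
  rw [integral_const_mul, integral_const_mul, integral_finsetSum _ i2] at e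
  refine (hint.trans e.le).trans ?_
  rw [add_mul, mul_assoc q, Finset.sum_mul]
  gcongr with j hj
  rw [integral_const_mul, mul_assoc]
  gcongr
  exact h u hu j (Finset.mem_range.1 hj)

/-- The Gagliardo–Nirenberg–Sobolev inequality in `W^{1,1}`, with real integrals. -/
theorem sobolev_one (hn : 2 ≤ n) : ∃ K : ℝ, 0 ≤ K ∧ ∀ g : EuclideanSpace ℝ (Fin n) → ℝ,
    ContDiff ℝ 1 g → HasCompactSupport g →
      (∫ x, |g x| ^ ((n : ℝ) / (n - 1))) ^ (((n : ℝ) - 1) / n) ≤ K * ∫ x, ‖fderiv ℝ g x‖ := by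
  have hn' : (2 : ℝ) ≤ n := by exact_mod_cast hn
  have hp0 : (0 : ℝ) < n / (n - 1) := div_pos (by linarith) (by linarith)
  let p : NNReal := ⟨(n : ℝ) / (n - 1), hp0.le⟩
  have hp : NNReal.HolderConjugate (Module.finrank ℝ (EuclideanSpace ℝ (Fin n))) p := by
    rw [finrank_euclideanSpace_fin, ← NNReal.holderConjugate_coe_iff]
    exact Real.HolderConjugate.conjExponent (by simp; linarith)
  refine ⟨eLpNormLESNormFDerivOneConst (volume : Measure (EuclideanSpace ℝ (Fin n))) p,
    NNReal.coe_nonneg _, fun g hg hgc => ?_⟩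
  have h := eLpNorm_le_eLpNorm_fderiv_one (volume : Measure (EuclideanSpace ℝ (Fin n))) hg hgc hp
  have hcont : Continuous (fderiv ℝ g) := hg.continuous_fderiv (by norm_num)
  have hi : Integrable fun x => fderiv ℝ g x :=
    hcont.integrable_of_hasCompactSupport (hgc.fderiv (𝕜 := ℝ))
  have hpe : (p : ENNReal) ≠ 0 := by
    have : p ≠ 0 := fun h' => hp0.ne' (congrArg NNReal.toReal h')
    exact_mod_cast this
  have hml : MemLp g p := hg.continuous.memLp_of_hasCompactSupport hgc
  rw [hml.eLpNorm_eq_integral_rpow_norm hpe ENNReal.coe_ne_top, eLpNorm_one_eq_lintegral_enorm,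
    ← ofReal_integral_norm_eq_lintegral_enorm hi,
    ← ENNReal.ofReal_coe_nnreal (p := eLpNormLESNormFDerivOneConst _ _), ← ENNReal.ofReal_mul (NNReal.coe_nonneg _), ENNReal.ofReal_le_ofReal_iff] at h
  · have e : (p : ENNReal).toReal = (n : ℝ) / (n - 1) := rfl
    rw [e, inv_div] at h
    exact h
  · exact mul_nonneg (NNReal.coe_nonneg _) (integral_nonneg fun x => norm_nonneg _)

/-- The critical Sobolev inequality for the energy relative to a strictly subcritical drift. -/
theorem sobolev_energy (hn : 3 ≤ n) {s : ℕ → ℝ} (hs : s 0 = 0)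
    (hpos : ∀ j < n, 0 < 2 * ((n : ℝ) - 1) / (n - 2) * s (j + 1) + j) :
    ∃ C : ℝ, 0 < C ∧ ∀ u : EuclideanSpace ℝ (Fin n) → ℝ, IsTestFunction (halfSpace n) u →
      C * (∫ x, |u x| ^ criticalExponent n) ^ (2 / criticalExponent n)
        ≤ ∫ x, ‖gradient u x - u x • drift s n x‖ ^ 2 := by
  have hn' : (3 : ℝ) ≤ n := by exact_mod_cast hn
  -- This q satisfies both q · n/(n-1) = 2* (Sobolev side) and 2(q-1) = 2* (Cauchy–Schwarz side).
  set q : ℝ := 2 * ((n : ℝ) - 1) / (n - 2) with hqdef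
  have hn2 : (0 : ℝ) < n - 2 := by linarith
  have hn1 : (0 : ℝ) < n - 1 := by linarith
  have hn0 : (0 : ℝ) < n := by linarith
  have hq : 1 < q := by rw [hqdef, lt_div_iff₀ hn2]; linarith
  obtain ⟨K₁, hK₁, h₁⟩ := integral_norm_fderiv_abs_rpow_le (n := n) hs hq hpos
  obtain ⟨K₂, hK₂, h₂⟩ := sobolev_one (n := n) (by omega)
  set c := criticalExponent n with hc
  have hcq : q * ((n : ℝ) / (n - 1)) = c := by
    rw [hqdef, hc, criticalExponent]; field_simp
  have hc2 : (q - 1) * 2 = c := by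
    rw [hqdef, hc, criticalExponent]; field_simp; ring
  have hcr : 2 / c = ((n : ℝ) - 2) / n := by
    rw [hc, criticalExponent]; field_simp
  set K := K₂ * K₁ + 1 with hK
  have hKpos : 0 < K := by positivity
  refine ⟨(K ^ 2)⁻¹, by positivity, fun u hu => ?_⟩
  have hq0 : 0 < q := by linarith
  have hA := h₂ _ (hu.contDiff_abs_rpow hq) (hu.hasCompactSupport_abs_rpow hq0)
  have hB := h₁ u hu
  have e : (fun x => |(|u x| ^ q)| ^ ((n : ℝ) / (n - 1))) = fun x => |u x| ^ c := by
    funext x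
    rw [abs_of_nonneg (by positivity), ← Real.rpow_mul (abs_nonneg _), hcq]
  rw [e] at hA
  set W := fun x => gradient u x - u x • drift s n x with hW
  have hWc := hu.continuous_gradient_sub_drift s
  have hWs := hu.hasCompactSupport_gradient_sub_drift s
  have hCS : ∫ x, |u x| ^ (q - 1) * ‖W x‖ ≤
      (∫ x, |u x| ^ c) ^ (1 / 2 : ℝ) * (∫ x, ‖W x‖ ^ 2) ^ (1 / 2 : ℝ) := by
    have := integral_mul_le_Lp_mul_Lq_of_nonneg (μ := volume) Real.HolderConjugate.two_two
      (f := fun x => |u x| ^ (q - 1)) (g := fun x => ‖W x‖)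
      (Eventually.of_forall fun x => by positivity) (Eventually.of_forall fun x => norm_nonneg _)
      ((hu.continuous_abs_rpow (by linarith)).memLp_of_hasCompactSupport
        (hu.hasCompactSupport_abs_rpow (by linarith)))
      (hWc.norm.memLp_of_hasCompactSupport hWs.norm)
    simpa only [← Real.rpow_mul (abs_nonneg _), hc2, Real.rpow_two] using this
  have hN0 : 0 ≤ ∫ x, |u x| ^ c := integral_nonneg fun x => by positivity
  have hE0 : 0 ≤ ∫ x, ‖W x‖ ^ 2 := integral_nonneg fun x => by positivity
  set N := ∫ x, |u x| ^ c with hN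
  set E := ∫ x, ‖W x‖ ^ 2 with hE
  rw [hcr]
  have hmain : N ^ (((n : ℝ) - 1) / n) ≤ K * (N ^ (1 / 2 : ℝ) * E ^ (1 / 2 : ℝ)) := by
    calc _ ≤ K₂ * (K₁ * (N ^ (1 / 2 : ℝ) * E ^ (1 / 2 : ℝ))) := by
          refine hA.trans ?_
          gcongr
          refine hB.trans ?_
          gcongr
      _ = K₂ * K₁ * (N ^ (1 / 2 : ℝ) * E ^ (1 / 2 : ℝ)) := by ring
      _ ≤ _ := by
          gcongr
          linarith
  rw [inv_mul_le_iff₀ (by positivity)]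
  rcases hN0.eq_or_lt with h0 | h0
  · rw [← h0, Real.zero_rpow (by positivity)]
    positivity
  -- Squared, the estimate reads N · N^{(n-2)/n} ≤ K² N E, and one factor N > 0 cancels.
  · have hsq := pow_le_pow_left₀ (by positivity) hmain 2
    have e1 : (N ^ (((n : ℝ) - 1) / n)) ^ 2 = N * N ^ (((n : ℝ) - 2) / n) := by
      nth_rewrite 2 [← Real.rpow_one N]
      rw [← Real.rpow_natCast, ← Real.rpow_mul h0.le, ← Real.rpow_add h0]
      congr 1
      field_simp
      push_cast
      ring
    have e2 : ∀ t : ℝ, 0 ≤ t → (t ^ (1 / 2 : ℝ)) ^ 2 = t := fun t ht => by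
      rw [← Real.sqrt_eq_rpow, Real.sq_sqrt ht]
    rw [e1, mul_pow, mul_pow, e2 N h0.le, e2 E hE0] at hsq
    nlinarith

/-! ### The Hardy potential and its ground state exponents -/

/-- The partial sums of the exponents of the ground state: `|X_1| |X_k|^{-k/2} ∏ |X_j|^{-1/2}`,
perturbed by `τ`. -/
def groundExp (k : ℕ) (τ : ℕ → ℝ) (j : ℕ) : ℝ :=
  if j = 0 then 0 else if j < k then 1 else -((j : ℝ) - 2) / 2 + τ j

theorem groundExp_zero (k : ℕ) (τ : ℕ → ℝ) : groundExp k τ 0 = 0 := if_pos rfl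

theorem groundExp_of_lt {k j : ℕ} (hj : j ≠ 0) (h : j < k) (τ : ℕ → ℝ) : groundExp k τ j = 1 := by
  rw [groundExp, if_neg hj, if_pos h]

theorem groundExp_of_le {k j : ℕ} (hj : j ≠ 0) (h : k ≤ j) (τ : ℕ → ℝ) :
    groundExp k τ j = -((j : ℝ) - 2) / 2 + τ j := by
  rw [groundExp, if_neg hj, if_neg (by omega)]

theorem driftCoeff_groundExp_of_lt {k j : ℕ} (h : j + 1 < k) (τ : ℕ → ℝ) :
    driftCoeff (groundExp k τ) j = 0 := by
  rw [driftCoeff, groundExp_of_lt (by omega) h]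
  rcases Nat.eq_zero_or_pos j with rfl | hj
  · rw [groundExp_zero]; norm_num
  · rw [groundExp_of_lt (by omega) (by omega)]; ring

theorem driftCoeff_groundExp_of_eq {k j : ℕ} (h : j + 1 = k) (τ : ℕ → ℝ) :
    driftCoeff (groundExp k τ) j = τ k ^ 2 - (k : ℝ) ^ 2 / 4 := by
  subst h
  rw [driftCoeff, groundExp_of_le (by omega) le_rfl]
  rcases Nat.eq_zero_or_pos j with rfl | hj
  · rw [groundExp_zero]; push_cast; ring
  · rw [groundExp_of_lt (by omega) (by omega)]; push_cast; ring

/-- With a = (j-1)/2 the exponents are s_{j+1} = -a + τ_{j+1} and s_j = -a + 1/2 + τ_j, so s² + 2as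
is a completed square for both and the a² cancels. -/
theorem driftCoeff_groundExp_of_gt {k j : ℕ} (hk : 0 < k) (h : k < j + 1) (τ : ℕ → ℝ) :
    driftCoeff (groundExp k τ) j = τ (j + 1) ^ 2 - (τ j + 1 / 2) ^ 2 := by
  rw [driftCoeff, groundExp_of_le (by omega) (by omega), groundExp_of_le (by omega) (by omega)]
  push_cast
  ring

/-- The coefficient of `1/|X_{j+1}|²` in the Hardy potential. -/
def hardyCoeff (n k : ℕ) (β : ℝ) (j : ℕ) : ℝ :=
  (if j + 1 = k then (k : ℝ) ^ 2 / 4 else 0) + (if k < j + 1 ∧ j + 1 < n then 1 / 4 else 0)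
    + if j + 1 = n then β else 0

theorem hardyPotential_eq_sum {k : ℕ} (hk : 1 ≤ k) (hkn : k ≤ n) (β : ℝ)
    (x : EuclideanSpace ℝ (Fin n)) :
    hardyPotential n k β x
      = ∑ j ∈ Finset.range n, hardyCoeff n k β j * (partialNormSq (j + 1) x)⁻¹ := by
  have single : ∀ (m : ℕ) (c : ℝ), 1 ≤ m → m ≤ n →
      ∑ j ∈ Finset.range n, (if j + 1 = m then c else 0) * (partialNormSq (j + 1) x)⁻¹
        = c / partialNormSq m x := by
    intro m c h1 h2
    rw [Finset.sum_eq_single (m - 1)]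
    · rw [Nat.sub_add_cancel h1, if_pos rfl, div_eq_mul_inv]
    · intro j _ hj
      rw [if_neg (by omega), zero_mul]
    · intro h
      exact absurd (Finset.mem_range.2 (by omega)) h
  have middle : ∑ j ∈ Finset.range n, (if k < j + 1 ∧ j + 1 < n then (1 / 4 : ℝ) else 0)
        * (partialNormSq (j + 1) x)⁻¹
      = ∑ j ∈ Finset.Icc (k + 1) (n - 1), (1 / 4 : ℝ) / partialNormSq j x := by
    simp only [ite_mul, zero_mul]
    rw [← Finset.sum_filter]
    refine Finset.sum_nbij' (fun j => j + 1) (fun j => j - 1) ?_ ?_ ?_ ?_ ?_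
    · intro j hj
      simp only [Finset.mem_filter, Finset.mem_range, Finset.mem_Icc] at hj ⊢
      omega
    · intro j hj
      simp only [Finset.mem_filter, Finset.mem_range, Finset.mem_Icc] at hj ⊢
      omega
    · intro j _
      simp
    · intro j hj
      simp only [Finset.mem_Icc] at hj
      omega
    · intro j _
      simp only [div_eq_mul_inv]
  simp only [hardyCoeff, add_mul, Finset.sum_add_distrib]
  rw [single k _ hk hkn, middle, single n _ (hk.trans hkn) le_rfl, hardyPotential]

/-! ### The Hardy deficit in ground state form, and the subcritical inequality. -/

theorem IsTestFunction.setIntegral_norm_gradient {u : EuclideanSpace ℝ (Fin n) → ℝ}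
    (hu : IsTestFunction (halfSpace n) u) :
    ∫ x in halfSpace n, ‖gradient u x‖ ^ 2 = ∫ x, ‖gradient u x‖ ^ 2 :=
  setIntegral_eq_integral_of_forall_compl_eq_zero fun x hx => by
    simp [gradient_eq_zero_of_notMem hu hx]

theorem IsTestFunction.setIntegral_rpow {u : EuclideanSpace ℝ (Fin n) → ℝ}
    (hu : IsTestFunction (halfSpace n) u) {c : ℝ} (hc : c ≠ 0) :
    ∫ x in halfSpace n, |u x| ^ c = ∫ x, |u x| ^ c :=
  setIntegral_eq_integral_of_forall_compl_eq_zero fun x hx => by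
    simp [hu.eq_zero hx, hc]

theorem IsTestFunction.setIntegral_hardyPotential {u : EuclideanSpace ℝ (Fin n) → ℝ}
    (hu : IsTestFunction (halfSpace n) u) {k : ℕ} (hk : 1 ≤ k) (hkn : k ≤ n) (β : ℝ) :
    ∫ x in halfSpace n, hardyPotential n k β x * |u x| ^ 2
      = ∑ j ∈ Finset.range n, hardyCoeff n k β j * ∫ x, (partialNormSq (j + 1) x)⁻¹ * u x ^ 2 := by
  rw [setIntegral_eq_integral_of_forall_compl_eq_zero fun x hx => by simp [hu.eq_zero hx]]
  simp only [hardyPotential_eq_sum hk hkn, sq_abs, Finset.sum_mul, mul_assoc]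
  rw [integral_finsetSum _ fun j _ =>
    (integrable_inv_partialNormSq_mul_sq hu j.succ_pos).const_mul _]
  exact Finset.sum_congr rfl fun j _ => integral_const_mul _ _

/-- Keeping τ arbitrary serves both halves of the theorem: the residual coefficients vanish in the
subcritical case and are controlled by sign in the critical one. -/
theorem IsTestFunction.energy_hardyPotential {u : EuclideanSpace ℝ (Fin n) → ℝ}
    (hu : IsTestFunction (halfSpace n) u) {k : ℕ} (hk : 1 ≤ k) (hkn : k ≤ n) (β : ℝ) (τ : ℕ → ℝ) :
    (∫ x in halfSpace n, ‖gradient u x‖ ^ 2)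
        - ∫ x in halfSpace n, hardyPotential n k β x * |u x| ^ 2
      = (∫ x, ‖gradient u x - u x • drift (groundExp k τ) n x‖ ^ 2)
        - ∑ j ∈ Finset.range n, (hardyCoeff n k β j + driftCoeff (groundExp k τ) j) *
            ∫ x, (partialNormSq (j + 1) x)⁻¹ * u x ^ 2 := by
  rw [hu.setIntegral_norm_gradient, hu.setIntegral_hardyPotential hk hkn,
    (energy_identity (groundExp_zero k τ) hu).2]
  simp only [add_mul, Finset.sum_add_distrib]
  ring

/-- The Hardy–Sobolev–Maz'ya inequality for a subcritical last coefficient. -/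
theorem exists_hardySobolevMazya (hn : 3 ≤ n) {k : ℕ} (hk : 1 ≤ k) (hkn : k ≤ n) {β : ℝ}
    (hβ : β < if k = n then 0 else 1 / 4) :
    ∃ C : ℝ, 0 < C ∧ HardySobolevMazya n (hardyPotential n k β) C := by
  have hn' : (3 : ℝ) ≤ n := by exact_mod_cast hn
  set b : ℝ := if k = n then 0 else 1 / 4 with hb
  -- Chosen so that the last coefficient, τ_n² minus the critical value, is the required one.
  set t : ℝ := √(b - β) with ht
  have ht0 : 0 < t := Real.sqrt_pos.2 (by linarith)
  have ht2 : t ^ 2 = b - β := Real.sq_sqrt (by linarith)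
  let τ : ℕ → ℝ := fun j => if j = n then t else 0
  have hτn : τ n = t := if_pos rfl
  have hτ : ∀ j, j ≠ n → τ j = 0 := fun j hj => if_neg hj
  have hpos : ∀ j < n, 0 < 2 * ((n : ℝ) - 1) / (n - 2) * groundExp k τ (j + 1) + j := by
    intro j hj
    have hn2 : (0 : ℝ) < n - 2 := by linarith
    have hn1 : (0 : ℝ) < n - 1 := by linarith
    by_cases hjk : j + 1 < k
    · rw [groundExp_of_lt (by omega) hjk]
      positivity
    · rw [groundExp_of_le (by omega) (by omega)]
      rcases (show j + 1 ≤ n from hj).eq_or_lt with h | h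
      -- At the last index the quantity reduces to q t, so strict subcriticality is what makes it
      -- positive; for the other indices from k on, t plays no role.
      · rw [h, hτn]
        have hjr : (j : ℝ) = n - 1 := by rw [← h]; push_cast; ring
        have : 2 * ((n : ℝ) - 1) / (n - 2) * (-((n : ℝ) - 2) / 2 + t) + j
            = 2 * ((n : ℝ) - 1) / (n - 2) * t := by
          rw [hjr]; field_simp; ring
        rw [this]
        positivity
      · rw [hτ _ h.ne]
        have hjr : (j : ℝ) + 1 < n := by exact_mod_cast h
        have : 2 * ((n : ℝ) - 1) / (n - 2) * (-(((j + 1 : ℕ) : ℝ) - 2) / 2 + 0) + j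
            = (n - 1 - j) / (n - 2) := by
          push_cast; field_simp; ring
        rw [this]
        exact div_pos (by linarith) hn2
  obtain ⟨C, hC, h⟩ := sobolev_energy hn (groundExp_zero k τ) hpos
  refine ⟨C, hC, fun u hu => ?_⟩
  have hE := hu.energy_hardyPotential hk hkn β τ
  have hzero : ∑ j ∈ Finset.range n, (hardyCoeff n k β j + driftCoeff (groundExp k τ) j) *
            ∫ x, (partialNormSq (j + 1) x)⁻¹ * u x ^ 2 = 0 := by
    refine Finset.sum_eq_zero fun j hj => ?_
    have hj := Finset.mem_range.1 hj
    convert zero_mul _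
    rcases lt_trichotomy (j + 1) k with hjk | hjk | hjk
    · rw [driftCoeff_groundExp_of_lt hjk, hardyCoeff, if_neg hjk.ne, if_neg (by omega),
        if_neg (by omega)]
      ring
    · rw [driftCoeff_groundExp_of_eq hjk, hardyCoeff, if_pos hjk, if_neg (by omega)]
      by_cases hkn' : k = n
      · rw [if_pos (by omega), hkn', hτn, ht2, hb, if_pos hkn']
        ring
      · rw [if_neg (by omega), hτ k hkn']
        ring
    · rw [driftCoeff_groundExp_of_gt hk hjk, hardyCoeff, if_neg hjk.ne', hτ j hj.ne]
      have hb' : b = 1 / 4 := if_neg (by omega)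
      by_cases hjn : j + 1 = n
      · rw [if_neg (by omega), if_pos hjn, hjn, hτn, ht2, hb']
        ring
      · rw [if_pos (by omega), if_neg hjn, hτ _ hjn]
        ring
  rw [hzero, sub_zero] at hE
  have hc : criticalExponent n ≠ 0 := by
    rw [criticalExponent]
    have : (0 : ℝ) < n - 2 := by linarith
    positivity
  rw [hu.setIntegral_rpow hc]
  have := h u hu
  linarith

/-! ### The ground state -/

/-- The function `∏_j |X_j|^{s_j - s_{j-1}}` on the half-space. -/
def groundState (s : ℕ → ℝ) (x : EuclideanSpace ℝ (Fin n)) : ℝ :=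
  -- The increments are halved because the logarithm is of the squared norm.
  Real.exp (∑ j ∈ Finset.range n, (s (j + 1) - s j) / 2 * Real.log (partialNormSq (j + 1) x))

theorem groundState_pos (s : ℕ → ℝ) (x : EuclideanSpace ℝ (Fin n)) : 0 < groundState s x :=
  Real.exp_pos _

theorem groundState_sq (s : ℕ → ℝ) (x : EuclideanSpace ℝ (Fin n)) :
    groundState s x ^ 2 = Real.exp
      (∑ j ∈ Finset.range n, (s (j + 1) - s j) * Real.log (partialNormSq (j + 1) x)) := by
  rw [groundState, ← Real.exp_nat_mul, Finset.mul_sum]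
  congr 1
  exact Finset.sum_congr rfl fun j _ => by push_cast; ring

theorem contDiffAt_groundState (s : ℕ → ℝ) {x : EuclideanSpace ℝ (Fin n)} (hx : x ∈ halfSpace n)
    {m : WithTop ℕ∞} : ContDiffAt ℝ m (groundState s) x := by
  unfold groundState
  refine (ContDiffAt.sum fun j _ => ?_).exp
  exact contDiffAt_const.mul
    ((contDiff_partialNormSq _).contDiffAt.log (partialNormSq_pos j.succ_pos hx).ne')

theorem hasGradientAt_groundState (s : ℕ → ℝ) {x : EuclideanSpace ℝ (Fin n)}
    (hx : x ∈ halfSpace n) :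
    HasGradientAt (groundState s) (groundState s x • drift s n x) x := by
  rw [hasGradientAt_iff_hasFDerivAt]
  have h := (HasFDerivAt.fun_sum (u := Finset.range n) fun j _ =>
    ((hasGradientAt_partialNormSq (j + 1) x).hasFDerivAt.log
      (partialNormSq_pos j.succ_pos hx).ne').const_mul ((s (j + 1) - s j) / 2)).exp
  refine h.congr_fderiv ?_
  rw [map_smul, drift, map_sum]
  congr 1
  refine Finset.sum_congr rfl fun j _ => ?_
  rw [map_smul, map_smul, smul_smul, smul_smul]
  congr 1
  ring

theorem continuousOn_groundState (s : ℕ → ℝ) :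
    ContinuousOn (groundState s : EuclideanSpace ℝ (Fin n) → ℝ) (halfSpace n) :=
  fun _ hx => (contDiffAt_groundState (m := 0) s hx).continuousAt.continuousWithinAt

theorem IsTestFunction.groundState_mul {v : EuclideanSpace ℝ (Fin n) → ℝ}
    (hv : IsTestFunction (halfSpace n) v) (s : ℕ → ℝ) :
    IsTestFunction (halfSpace n) fun x => groundState s x * v x where
  smooth := by
    rw [contDiff_iff_contDiffAt]
    intro x
    by_cases hx : x ∈ tsupport v
    · exact (contDiffAt_groundState s (hv.support_subset hx)).mul hv.smooth.contDiffAt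
    · have h0 : v =ᶠ[𝓝 x] 0 := notMem_tsupport_iff_eventuallyEq.1 hx
      refine (contDiffAt_const (c := (0 : ℝ))).congr_of_eventuallyEq ?_
      filter_upwards [h0] with y hy
      simp [hy]
  compactSupport := hv.compactSupport.mul_left
  support_subset := tsupport_mul_subset_right.trans hv.support_subset

/-- Since ∇Φ = Φ · drift, the product rule leaves only Φ∇v. -/
theorem norm_gradient_groundState_mul_sub_drift {v : EuclideanSpace ℝ (Fin n) → ℝ}
    (hv : IsTestFunction (halfSpace n) v) (s : ℕ → ℝ) (x : EuclideanSpace ℝ (Fin n)) :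
    ‖gradient (fun y => groundState s y * v y) x - (groundState s x * v x) • drift s n x‖ ^ 2
      = groundState s x ^ 2 * ‖gradient v x‖ ^ 2 := by
  by_cases hx : x ∈ halfSpace n
  · have h1 : HasFDerivAt (groundState s) _ x := (hasGradientAt_groundState s hx).hasFDerivAt
    have h2 := (hv.contDiff_one.differentiable (by norm_num) x).hasGradientAt.hasFDerivAt
    have h3 := h1.mul h2
    rw [← map_smul, ← map_smul, ← map_add] at h3
    have h4 : gradient (fun y => groundState s y * v y) x = _ :=
      HasGradientAt.gradient (hasGradientAt_iff_hasFDerivAt.2 h3)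
    rw [h4, smul_smul, mul_comm (v x), add_sub_cancel_right, norm_smul, mul_pow, Real.norm_eq_abs,
      sq_abs]
  · rw [gradient_eq_zero_of_notMem (hv.groundState_mul s) hx, gradient_eq_zero_of_notMem hv hx,
      hv.eq_zero hx]
    simp

/-! ### Comparison and scaling of ground states -/

/-- Abel summation: the boundary term is the right-hand side, and the rest is a sum of the d_j ≥ 0
against the increments of l, with a minus sign. -/
theorem sum_sub_mul_le {d l : ℕ → ℝ} (h0 : d 0 = 0) (hl : Monotone l) (m : ℕ)
    (hd : ∀ j, 1 ≤ j → j ≤ m → 0 ≤ d j) :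
    ∑ j ∈ Finset.range (m + 1), (d (j + 1) - d j) * l j ≤ d (m + 1) * l m := by
  induction m with
  | zero => simp [h0]
  | succ m ih =>
    rw [Finset.sum_range_succ]
    have h1 := ih fun j h1 h2 => hd j h1 (by omega)
    have h2 := mul_le_mul_of_nonneg_left (hl m.le_succ) (hd (m + 1) (by omega) le_rfl)
    simp only [Nat.succ_eq_add_one] at h2
    linarith

theorem monotone_log_partialNormSq {x : EuclideanSpace ℝ (Fin n)} (hx : x ∈ halfSpace n) :
    Monotone fun j => Real.log (partialNormSq (j + 1) x) := fun i j hij =>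
  Real.log_le_log (partialNormSq_pos i.succ_pos hx) (partialNormSq_mono (by omega) x)

/-- The difference of the logarithms is an Abel sum against log |X_j|², which increases with j.
Raising the intermediate exponents therefore lowers the ground state, up to a power of |x|. -/
theorem groundState_sq_le {s s' : ℕ → ℝ} (h0 : s 0 = s' 0)
    (hss : ∀ j, 1 ≤ j → j < n → s' j ≤ s j) {x : EuclideanSpace ℝ (Fin n)}
    (hx : x ∈ halfSpace n) :
    groundState s x ^ 2
      ≤ Real.exp ((s n - s' n) * Real.log (partialNormSq n x)) * groundState s' x ^ 2 := by
  obtain ⟨m, rfl⟩ : ∃ m, n = m + 1 := ⟨n - 1, by have := hx.1; omega⟩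
  rw [groundState_sq, groundState_sq, ← Real.exp_add, Real.exp_le_exp]
  have := sum_sub_mul_le (d := fun j => s j - s' j) (by simp [h0]) (monotone_log_partialNormSq hx) m
    fun j h1 h2 => sub_nonneg.2 (hss j h1 (by omega))
  rw [← sub_le_iff_le_add, ← Finset.sum_sub_distrib]
  refine le_trans (le_of_eq (Finset.sum_congr rfl fun j _ => ?_)) this
  ring

theorem groundState_sq_smul {s : ℕ → ℝ} (h0 : s 0 = 0) {R : ℝ} (hR : 0 < R)
    {x : EuclideanSpace ℝ (Fin n)} (hx : x ∈ halfSpace n) :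
    groundState s (R • x) ^ 2 = Real.exp (2 * s n * Real.log R) * groundState s x ^ 2 := by
  rw [groundState_sq, groundState_sq, ← Real.exp_add]
  congr 1
  have h : ∀ j, Real.log (partialNormSq (j + 1) (R • x))
      = 2 * Real.log R + Real.log (partialNormSq (j + 1) x) := fun j => by
    rw [partialNormSq_smul, Real.log_mul (by positivity) (partialNormSq_pos j.succ_pos hx).ne',
      Real.log_pow]
    norm_num
  simp only [h, mul_add, Finset.sum_add_distrib, ← Finset.sum_mul]
  rw [Finset.sum_range_sub, h0]
  ring

/-! ### Integrability of ground states -/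

/-- A dilation invariant family of half annuli. -/
def logAnnulus (n : ℕ) (a b : ℝ) : Set (EuclideanSpace ℝ (Fin n)) :=
  {x | x ∈ halfSpace n ∧ a ≤ Real.log (partialNormSq n x) ∧ Real.log (partialNormSq n x) ≤ b}

theorem measurableSet_logAnnulus (a b : ℝ) : MeasurableSet (logAnnulus n a b) := by
  have h : Measurable fun x : EuclideanSpace ℝ (Fin n) => Real.log (partialNormSq n x) :=
    Real.measurable_log.comp (continuous_partialNormSq n).measurable
  exact isOpen_halfSpace.measurableSet.inter
    ((measurableSet_le measurable_const h).inter (measurableSet_le h measurable_const))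

theorem logAnnulus_subset {a b a' b' : ℝ} (ha : a' ≤ a) (hb : b ≤ b') :
    logAnnulus n a b ⊆ logAnnulus n a' b' :=
  fun _ hx => ⟨hx.1, ha.trans hx.2.1, hx.2.2.trans hb⟩

theorem intervalIntegrable_abs_rpow {r : ℝ} (hr : -1 < r) {R : ℝ} (hR : 0 ≤ R) :
    IntervalIntegrable (fun t : ℝ => |t| ^ r) volume (-R) R := by
  have h1 : IntervalIntegrable (fun t : ℝ => |t| ^ r) volume 0 R := by
    refine (intervalIntegral.intervalIntegrable_rpow' hr).congr fun t ht => ?_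
    rw [uIoc_of_le hR] at ht
    simp only [abs_of_pos ht.1]
  have h2 := (IntervalIntegrable.iff_comp_neg enorm_ne_top).1 h1
  simp only [abs_neg, neg_zero] at h2
  exact h2.symm.trans h1

theorem integrable_prod_abs_rpow {r : ℝ} (hr : -1 < r) {R : ℝ} (hR : 0 ≤ R) :
    Integrable fun x : EuclideanSpace ℝ (Fin n) =>
      ∏ i, (Ioc (-R) R).indicator (fun t : ℝ => |t| ^ r) (x i) := by
  have h1 : Integrable ((Ioc (-R) R).indicator fun t : ℝ => |t| ^ r) := by
    rw [integrable_indicator_iff measurableSet_Ioc]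
    exact (intervalIntegrable_iff_integrableOn_Ioc_of_le (by linarith)).1
      (intervalIntegrable_abs_rpow hr hR)
  have h2 := Integrable.fintype_prod (ι := Fin n) (μ := fun _ => (volume : Measure ℝ))
    fun _ => h1
  exact (PiLp.volume_preserving_ofLp (Fin n)).integrable_comp_of_integrable h2

theorem ae_coord_ne_zero : ∀ᵐ x : EuclideanSpace ℝ (Fin n), ∀ i, x i ≠ 0 := by
  rw [ae_all_iff]
  intro i
  have h : ∀ᵐ y : Fin n → ℝ, y i ≠ 0 := by
    rw [ae_iff]
    simp only [not_not]
    exact Measure.pi_hyperplane (fun _ => (volume : Measure ℝ)) i 0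
  exact (PiLp.volume_preserving_ofLp (Fin n)).quasiMeasurePreserving.ae h

/-- Linear exponents give ∏ |X_j|^r, and |X_j| ≥ |x_j| with r ≤ 0. -/
theorem groundState_linear_sq_le {r : ℝ} (hr : r ≤ 0) {x : EuclideanSpace ℝ (Fin n)}
    (hx : ∀ i, x i ≠ 0) :
    groundState (fun j => r * j / 2) x ^ 2 ≤ ∏ i, |x i| ^ r := by
  rw [groundState_sq, Real.exp_sum, ← Fin.prod_univ_eq_prod_range
    (fun j => Real.exp ((r * ((j + 1 : ℕ) : ℝ) / 2 - r * j / 2) *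
      Real.log (partialNormSq (j + 1) x))) n]
  refine Finset.prod_le_prod (fun _ _ => (Real.exp_pos _).le) fun i _ => ?_
  have hi := abs_pos.2 (hx i)
  rw [Real.rpow_def_of_pos hi, Real.exp_le_exp]
  have h1 := Real.log_le_log (by have := hx i; positivity) (sq_le_partialNormSq x i (Nat.lt_succ_self i))
  rw [← sq_abs, Real.log_pow] at h1
  push_cast at h1 ⊢
  simp only [Nat.succ_eq_add_one] at h1
  nlinarith

/-- Comparison with linear exponents reduces the question to ∏ |x_i|^r on a box, integrable since r
> -1. The remaining power of |x| is bounded on the annulus, so s_n needs no condition. -/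
theorem integrableOn_groundState_sq {s : ℕ → ℝ} (h0 : s 0 = 0) {r : ℝ} (hr : -1 < r) (hr0 : r ≤ 0)
    (hs : ∀ j, 1 ≤ j → j < n → r * j / 2 ≤ s j) (a b : ℝ) :
    IntegrableOn (fun x : EuclideanSpace ℝ (Fin n) => groundState s x ^ 2) (logAnnulus n a b) := by
  set M := Real.exp (|s n - r * n / 2| * max |a| |b|) with hM
  set R := Real.exp |b| + 1 with hR
  have hmaj := (integrable_prod_abs_rpow (n := n) hr (R := R) (by positivity)).const_mul M
  refine Integrable.mono' hmaj.integrableOn ?_ ?_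
  · exact (((continuousOn_groundState s).pow 2).mono fun x hx => hx.1).aestronglyMeasurable
      (measurableSet_logAnnulus a b)
  · rw [ae_restrict_iff' (measurableSet_logAnnulus a b)]
    filter_upwards [ae_coord_ne_zero (n := n)] with x hx0 hx
    have hn : 0 < n := hx.1.1
    rw [Real.norm_of_nonneg (sq_nonneg _)]
    have hN := partialNormSq_pos hn hx.1
    have h1 := groundState_sq_le (s := s) (s' := fun j => r * j / 2) (by simp [h0]) hs hx.1
    have h2 := groundState_linear_sq_le hr0 hx0
    have h3 : ∏ i, |x i| ^ r = ∏ i, (Ioc (-R) R).indicator (fun t : ℝ => |t| ^ r) (x i) := by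
      refine Finset.prod_congr rfl fun i _ => ?_
      rw [indicator_of_mem]
      have h4 : x i ^ 2 ≤ Real.exp |b| :=
        (sq_le_partialNormSq x i i.2).trans
          ((Real.log_le_iff_le_exp hN).1 (hx.2.2.trans (le_abs_self b)))
      have h5 : (1 : ℝ) ≤ Real.exp |b| := Real.one_le_exp (abs_nonneg b)
      have h6 : |x i| < R := abs_lt_of_sq_lt_sq (by nlinarith) (by linarith)
      exact ⟨(abs_lt.1 h6).1, (abs_lt.1 h6).2.le⟩
    rw [← h3]
    refine h1.trans (mul_le_mul ?_ h2 (sq_nonneg _) (Real.exp_pos _).le)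
    rw [hM, Real.exp_le_exp]
    refine (le_abs_self _).trans ?_
    rw [abs_mul]
    gcongr
    exact abs_le_max_abs_abs hx.2.1 hx.2.2

/-! ### Cutoff functions -/

theorem exists_smooth_step : ∃ (η : ℝ → ℝ) (C : ℝ), ContDiff ℝ (⊤ : ℕ∞) η ∧
    (∀ t, 0 ≤ η t ∧ η t ≤ 1) ∧ (∀ t ≤ 1, η t = 0) ∧ (∀ t, 2 ≤ t → η t = 1) ∧
    (∀ t, |deriv η t| ≤ C) ∧ ∀ t, 2 < t → deriv η t = 0 := by
  let η : ℝ → ℝ := fun t => Real.smoothTransition (t - 1)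
  have hη : ContDiff ℝ (⊤ : ℕ∞) η :=
    Real.smoothTransition.contDiff.comp (contDiff_id.sub contDiff_const)
  have h0 : ∀ t ≤ 1, η t = 0 := fun t ht => Real.smoothTransition.zero_of_nonpos (by linarith)
  have h1 : ∀ t, 2 ≤ t → η t = 1 := fun t ht => Real.smoothTransition.one_of_one_le (by linarith)
  have hd0 : ∀ t < 1, deriv η t = 0 := fun t ht => by
    have : η =ᶠ[𝓝 t] fun _ => 0 := by
      filter_upwards [Iio_mem_nhds ht] with y hy using h0 y hy.le
    rw [this.deriv_eq, deriv_const]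
  have hd1 : ∀ t, 2 < t → deriv η t = 0 := fun t ht => by
    have : η =ᶠ[𝓝 t] fun _ => 1 := by
      filter_upwards [Ioi_mem_nhds ht] with y hy using h1 y hy.le
    rw [this.deriv_eq, deriv_const]
  have hcs : HasCompactSupport (deriv η) := by
    refine HasCompactSupport.of_support_subset_isCompact (isCompact_Icc (a := 1) (b := 2))
      fun t ht => ?_
    by_contra h
    rw [mem_Icc, not_and_or, not_le, not_le] at h
    exact ht (h.elim (hd0 t) (hd1 t))
  obtain ⟨C, hC⟩ := (hη.continuous_deriv (by norm_cast)).bounded_above_of_compact_support hcs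
  exact ⟨η, C, hη, fun t => ⟨Real.smoothTransition.nonneg _, Real.smoothTransition.le_one _⟩,
    h0, h1, hC, hd1⟩

theorem exists_smooth_bump : ∃ (ψ : ℝ → ℝ) (C : ℝ), ContDiff ℝ (⊤ : ℕ∞) ψ ∧
    (∀ t, 0 ≤ ψ t ∧ ψ t ≤ 1) ∧ (∀ t, |t| ≤ 1 → ψ t = 1) ∧ (∀ t, 2 ≤ |t| → ψ t = 0) ∧
    (∀ t, |deriv ψ t| ≤ C) ∧ ∀ t, 2 < |t| → deriv ψ t = 0 := by
  let ψ : ContDiffBump (0 : ℝ) := ⟨1, 2, one_pos, one_lt_two⟩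
  have h0 : ∀ t : ℝ, 2 ≤ |t| → ψ t = 0 := fun t ht =>
    ψ.zero_of_le_dist (by simpa [Real.dist_eq] using ht)
  obtain ⟨C, hC⟩ := ((ψ.contDiff (n := (⊤ : ℕ∞))).continuous_deriv
    (by norm_cast)).bounded_above_of_compact_support ψ.hasCompactSupport.deriv
  refine ⟨ψ, C, ψ.contDiff, fun t => ⟨ψ.nonneg, ψ.le_one⟩, fun t ht =>
    ψ.one_of_mem_closedBall (by simpa [Real.dist_eq] using ht), h0, hC, fun t ht => ?_⟩
  have : (ψ : ℝ → ℝ) =ᶠ[𝓝 t] fun _ => 0 := by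
    filter_upwards [continuous_abs.continuousAt.eventually (Ioi_mem_nhds ht)] with y hy
      using h0 y hy.le
  rw [this.deriv_eq, deriv_const]

/-- The cutoff in the distance to the boundary and in the logarithm of the distance to the
origin. -/
def cutoff (hn : 0 < n) (η ψ : ℝ → ℝ) (δ m : ℝ) (x : EuclideanSpace ℝ (Fin n)) : ℝ :=
  η (x ⟨0, hn⟩ / δ) * ψ (Real.log (partialNormSq n x) / m)

theorem isTestFunction_cutoff (hn : 0 < n) {η ψ : ℝ → ℝ} (hη : ContDiff ℝ (⊤ : ℕ∞) η)
    (hη0 : ∀ t ≤ 1, η t = 0) (hψ : ContDiff ℝ (⊤ : ℕ∞) ψ) (hψ0 : ∀ t, 2 ≤ |t| → ψ t = 0)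
    {δ m : ℝ} (hδ : 0 < δ) (hm : 0 < m) : IsTestFunction (halfSpace n) (cutoff hn η ψ δ m) := by
  have hzero : ∀ x : EuclideanSpace ℝ (Fin n), x ⟨0, hn⟩ ≤ δ → cutoff hn η ψ δ m x = 0 := by
    intro x hx
    rw [cutoff, hη0 _ ((div_le_one hδ).2 hx), zero_mul]
  have hsupp : Function.support (cutoff hn η ψ δ m) ⊆
      {x | δ ≤ x ⟨0, hn⟩} ∩ Metric.closedBall 0 (Real.exp (2 * m)) := by
    intro x hx
    have h1 : δ < x ⟨0, hn⟩ := by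
      by_contra h
      exact hx (hzero x (not_lt.1 h))
    refine ⟨h1.le, ?_⟩
    have hN := partialNormSq_pos hn ((mem_halfSpace hn).2 (hδ.trans h1))
    have h2 : |Real.log (partialNormSq n x) / m| < 2 := by
      by_contra h
      refine hx ?_
      rw [cutoff, hψ0 _ (not_lt.1 h), mul_zero]
    have h3 := (abs_lt.1 h2).2
    rw [div_lt_iff₀ hm, Real.log_lt_iff_lt_exp hN, partialNormSq_self] at h3
    have h4 : (1 : ℝ) ≤ Real.exp (2 * m) := Real.one_le_exp (by positivity)
    rw [mem_closedBall_zero_iff]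
    exact (abs_le_of_sq_le_sq (by nlinarith) (by linarith) : |‖x‖| ≤ _) |> le_of_abs_le
  have hclosed : IsClosed ({x : EuclideanSpace ℝ (Fin n) | δ ≤ x ⟨0, hn⟩} ∩
      Metric.closedBall 0 (Real.exp (2 * m))) :=
    (isClosed_le continuous_const (by fun_prop)).inter Metric.isClosed_closedBall
  refine ⟨?_, ?_, ?_⟩
  · rw [contDiff_iff_contDiffAt]
    intro x
    by_cases hx : x ∈ halfSpace n
    · have h1 : ContDiffAt ℝ (⊤ : ℕ∞) (fun y : EuclideanSpace ℝ (Fin n) => y ⟨0, hn⟩ / δ) x := by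
        fun_prop
      have h2 : ContDiffAt ℝ (⊤ : ℕ∞) (fun y : EuclideanSpace ℝ (Fin n) =>
          Real.log (partialNormSq n y) / m) x :=
        (((contDiff_partialNormSq n).contDiffAt.log (partialNormSq_pos hn hx).ne')).div_const m
      exact (hη.contDiffAt.comp x h1).mul (hψ.contDiffAt.comp x h2)
    · refine (contDiffAt_const (c := (0 : ℝ))).congr_of_eventuallyEq ?_
      have hx' : x ⟨0, hn⟩ < δ := by
        rw [mem_halfSpace hn, not_lt] at hx
        linarith
      have hc : ContinuousAt (fun y : EuclideanSpace ℝ (Fin n) => y ⟨0, hn⟩) x := by fun_prop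
      filter_upwards [hc.eventually (Iio_mem_nhds hx')] with y hy using hzero y (le_of_lt hy)
  · exact HasCompactSupport.of_support_subset_isCompact
      ((isCompact_closedBall _ _).of_isClosed_subset hclosed inter_subset_right) hsupp
  · exact (closure_minimal hsupp hclosed).trans fun x hx => (mem_halfSpace hn).2 (hδ.trans_le hx.1)

theorem gradient_cutoff (hn : 0 < n) {η ψ : ℝ → ℝ} (hη : ContDiff ℝ (⊤ : ℕ∞) η)
    (hψ : ContDiff ℝ (⊤ : ℕ∞) ψ) {δ m : ℝ} {x : EuclideanSpace ℝ (Fin n)}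
    (hx : x ∈ halfSpace n) :
    gradient (cutoff hn η ψ δ m) x
      = (ψ (Real.log (partialNormSq n x) / m) * (deriv η (x ⟨0, hn⟩ / δ) / δ)) •
          EuclideanSpace.single ⟨0, hn⟩ (1 : ℝ)
        + (η (x ⟨0, hn⟩ / δ) * (deriv ψ (Real.log (partialNormSq n x) / m) * (m⁻¹ *
          ((partialNormSq n x)⁻¹ * 2)))) • x := by
  refine HasGradientAt.gradient (hasGradientAt_iff_hasFDerivAt.2 ?_)
  have h1 : HasFDerivAt (fun y : EuclideanSpace ℝ (Fin n) => y ⟨0, hn⟩ / δ) _ x :=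
    (EuclideanSpace.proj (𝕜 := ℝ) (⟨0, hn⟩ : Fin n)).hasFDerivAt.mul_const δ⁻¹
  have h2 := ((hasGradientAt_partialNormSq n x).hasFDerivAt.log
    (partialNormSq_pos hn hx).ne').mul_const m⁻¹
  have h3 := ((hη.differentiable (by norm_num) (x ⟨0, hn⟩ / δ)).hasDerivAt.comp_hasFDerivAt x
    h1).mul (HasDerivAt.comp_hasFDerivAt (h₂ := ψ) x
      (hψ.differentiable (by norm_num) (Real.log (partialNormSq n x) * m⁻¹)).hasDerivAt h2)
  refine h3.congr_fderiv ?_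
  ext v
  simp only [headProj_self, map_smul, map_add, div_eq_mul_inv]
  simp [EuclideanSpace.inner_single_left]
  ring

/-- The derivative of η lives where x_1 ≤ 2δ, so 1/δ² ≤ 4/x_1² there; the other term uses |∇ log
|x|²| = 2/|x|. Replacing δ^{-2} by x_1^{-2} gives a majorant whose only dependence on δ is the
strip. -/
theorem norm_gradient_cutoff_sq_le (hn : 0 < n) {η ψ : ℝ → ℝ} {C₁ C₂ : ℝ}
    (hη : ContDiff ℝ (⊤ : ℕ∞) η) (hη1 : ∀ t, 0 ≤ η t ∧ η t ≤ 1) (hηC : ∀ t, |deriv η t| ≤ C₁)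
    (hηd : ∀ t, 2 < t → deriv η t = 0)
    (hψ : ContDiff ℝ (⊤ : ℕ∞) ψ) (hψ1 : ∀ t, 0 ≤ ψ t ∧ ψ t ≤ 1) (hψC : ∀ t, |deriv ψ t| ≤ C₂)
    (hψ0 : ∀ t, 2 ≤ |t| → ψ t = 0) (hψd : ∀ t, 2 < |t| → deriv ψ t = 0)
    {δ m : ℝ} (hδ : 0 < δ) (hm : 0 < m) {x : EuclideanSpace ℝ (Fin n)} (hx : x ∈ halfSpace n) :
    ‖gradient (cutoff hn η ψ δ m) x‖ ^ 2 ≤ (logAnnulus n (-(2 * m)) (2 * m)).indicator (fun x =>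
        8 * C₂ ^ 2 / m ^ 2 * (partialNormSq n x)⁻¹ +
        {x | partialNormSq 1 x ≤ 4 * δ ^ 2}.indicator
          (fun x => 8 * C₁ ^ 2 * (partialNormSq 1 x)⁻¹) x) x := by
  have hN := partialNormSq_pos hn hx
  have hx0 := (mem_halfSpace hn).1 hx
  rw [gradient_cutoff hn hη hψ hx]
  set t := Real.log (partialNormSq n x) / m with ht
  by_cases hA : x ∈ logAnnulus n (-(2 * m)) (2 * m)
  swap
  · have ht2 : 2 < |t| := by
      by_contra h
      rw [not_lt, abs_le, ht, le_div_iff₀ hm, div_le_iff₀ hm] at h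
      exact hA ⟨hx, by linarith [h.1], h.2⟩
    rw [indicator_of_notMem hA, hψ0 t ht2.le, hψd t ht2]
    simp
  rw [indicator_of_mem hA]
  set a := (ψ t * (deriv η (x ⟨0, hn⟩ / δ) / δ)) • EuclideanSpace.single (⟨0, hn⟩ : Fin n) (1 : ℝ)
    with ha
  set b := (η (x ⟨0, hn⟩ / δ) * (deriv ψ t * (m⁻¹ * ((partialNormSq n x)⁻¹ * 2)))) • x with hb
  have hb2 : ‖b‖ ^ 2 ≤ 4 * C₂ ^ 2 / m ^ 2 * (partialNormSq n x)⁻¹ := by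
    rw [hb, norm_smul, mul_pow, ← partialNormSq_self, Real.norm_eq_abs, sq_abs, mul_pow, mul_pow]
    have e1 : η (x ⟨0, hn⟩ / δ) ^ 2 ≤ 1 := pow_le_one₀ (hη1 _).1 (hη1 _).2
    have e2 : deriv ψ t ^ 2 ≤ C₂ ^ 2 := by
      rw [← sq_abs]; exact pow_le_pow_left₀ (abs_nonneg _) (hψC t) 2
    calc η (x ⟨0, hn⟩ / δ) ^ 2 * (deriv ψ t ^ 2 * (m⁻¹ * ((partialNormSq n x)⁻¹ * 2)) ^ 2)
          * partialNormSq n x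
        ≤ 1 * (C₂ ^ 2 * (m⁻¹ * ((partialNormSq n x)⁻¹ * 2)) ^ 2) * partialNormSq n x := by
          gcongr
      _ = _ := by field_simp; ring
  have ha2 : ‖a‖ ^ 2 ≤ {x | partialNormSq 1 x ≤ 4 * δ ^ 2}.indicator
      (fun x : EuclideanSpace ℝ (Fin n) => 4 * C₁ ^ 2 * (partialNormSq 1 x)⁻¹) x := by
    rw [ha, norm_smul, PiLp.norm_single, norm_one, mul_one, Real.norm_eq_abs, sq_abs]
    by_cases hd : x ⟨0, hn⟩ ≤ 2 * δ
    · rw [indicator_of_mem (by rw [mem_ofPred_eq, partialNormSq_one hn]; nlinarith),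
        partialNormSq_one hn, mul_pow]
      have e1 : ψ t ^ 2 ≤ 1 := pow_le_one₀ (hψ1 _).1 (hψ1 _).2
      have e2 : deriv η (x ⟨0, hn⟩ / δ) ^ 2 ≤ C₁ ^ 2 := by
        rw [← sq_abs]; exact pow_le_pow_left₀ (abs_nonneg _) (hηC _) 2
      calc ψ t ^ 2 * (deriv η (x ⟨0, hn⟩ / δ) / δ) ^ 2 ≤ 1 * (C₁ / δ) ^ 2 := by
            rw [div_pow, div_pow]; gcongr
        _ ≤ _ := by
            rw [one_mul, div_pow, div_le_iff₀ (by positivity), mul_right_comm, mul_assoc,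
              mul_right_comm]
            have : 1 ≤ 4 * δ ^ 2 * (x ⟨0, hn⟩ ^ 2)⁻¹ := by
              rw [← div_eq_mul_inv, le_div_iff₀ (by positivity)]
              nlinarith
            nlinarith [sq_nonneg C₁]
    · have : deriv η (x ⟨0, hn⟩ / δ) = 0 := hηd _ (by rw [lt_div_iff₀ hδ]; linarith)
      rw [this]
      simp only [zero_div, mul_zero, ne_eq, OfNat.ofNat_ne_zero, not_false_eq_true, zero_pow]
      exact indicator_nonneg (fun y _ => mul_nonneg (by positivity)
        (inv_nonneg.2 (partialNormSq_nonneg _ _))) _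
  have hab : ‖a + b‖ ^ 2 ≤ 2 * ‖a‖ ^ 2 + 2 * ‖b‖ ^ 2 := by
    have := pow_le_pow_left₀ (norm_nonneg _) (norm_add_le a b) 2
    nlinarith [sq_nonneg (‖a‖ - ‖b‖)]
  have hdbl : {x | partialNormSq 1 x ≤ 4 * δ ^ 2}.indicator
      (fun x : EuclideanSpace ℝ (Fin n) => 8 * C₁ ^ 2 * (partialNormSq 1 x)⁻¹) x
      = 2 * {x | partialNormSq 1 x ≤ 4 * δ ^ 2}.indicator
      (fun x : EuclideanSpace ℝ (Fin n) => 4 * C₁ ^ 2 * (partialNormSq 1 x)⁻¹) x := by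
    by_cases h : x ∈ {x : EuclideanSpace ℝ (Fin n) | partialNormSq 1 x ≤ 4 * δ ^ 2}
    · rw [indicator_of_mem h, indicator_of_mem h]; ring
    · rw [indicator_of_notMem h, indicator_of_notMem h, mul_zero]
  rw [hdbl]
  calc _ ≤ _ := hab
    _ ≤ 2 * _ + 2 * _ := add_le_add (mul_le_mul_of_nonneg_left ha2 two_pos.le)
        (mul_le_mul_of_nonneg_left hb2 two_pos.le)
    _ = _ := by ring

/-! ### Failure of the inequality at the critical coefficient -/

/-- The residual coefficient of 1/|X_{j+1}|² for k < j + 1 < n is τ_{j+1}² - τ_j² - τ_j ≥ 0, which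
only lowers the deficit. Only the coefficient of 1/|x|² can have the wrong sign, by at most ε. -/
theorem critical_energy_le {k : ℕ} (hk : 1 ≤ k) (hkn : k ≤ n) {τ : ℕ → ℝ} (hτn : τ n = 0)
    (hτ : ∀ j, k ≤ j → j + 1 < n → τ j ^ 2 + τ j ≤ τ (j + 1) ^ 2) {ε : ℝ} (hε : 0 ≤ ε)
    (hτε : τ (n - 1) ^ 2 + τ (n - 1) ≤ ε)
    {v : EuclideanSpace ℝ (Fin n) → ℝ} (hv : IsTestFunction (halfSpace n) v) :
    (∫ x in halfSpace n, ‖gradient (fun y => groundState (groundExp k τ) y * v y) x‖ ^ 2)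
        - ∫ x in halfSpace n, hardyPotential n k (if k = n then 0 else 1 / 4) x *
            |groundState (groundExp k τ) x * v x| ^ 2
      ≤ (∫ x, groundState (groundExp k τ) x ^ 2 * ‖gradient v x‖ ^ 2)
        + ε * ∫ x, (partialNormSq n x)⁻¹ * (groundState (groundExp k τ) x * v x) ^ 2 := by
  have hu := hv.groundState_mul (groundExp k τ)
  rw [hu.energy_hardyPotential hk hkn _ τ]
  simp only [norm_gradient_groundState_mul_sub_drift hv]
  rw [sub_eq_add_neg]
  refine add_le_add le_rfl ?_
  set I : ℕ → ℝ := fun j =>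
    ∫ x, (partialNormSq j x)⁻¹ * (groundState (groundExp k τ) x * v x) ^ 2 with hI
  have hI0 : ∀ j, 0 ≤ I j := fun j => integral_nonneg fun x =>
    mul_nonneg (inv_nonneg.2 (partialNormSq_nonneg j x)) (sq_nonneg _)
  have hlast : ∑ j ∈ Finset.range n, (if j + 1 = n then ε * I (j + 1) else 0) = ε * I n := by
    rw [Finset.sum_eq_single (n - 1)]
    · rw [if_pos (by omega), show n - 1 + 1 = n by omega]
    · intro j _ hj
      rw [if_neg (by omega)]
    · intro h
      exact absurd (Finset.mem_range.2 (by omega)) h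
  rw [← hlast, ← Finset.sum_neg_distrib]
  refine Finset.sum_le_sum fun j hj => ?_
  have hj := Finset.mem_range.1 hj
  have hIj := hI0 (j + 1)
  rw [← neg_mul]
  have key : -(hardyCoeff n k (if k = n then 0 else 1 / 4) j + driftCoeff (groundExp k τ) j)
      ≤ if j + 1 = n then ε else 0 := by
    rcases lt_trichotomy (j + 1) k with hjk | hjk | hjk
    · rw [driftCoeff_groundExp_of_lt hjk, hardyCoeff, if_neg hjk.ne, if_neg (by omega),
        if_neg (by omega), if_neg (by omega)]
      simp
    · rw [driftCoeff_groundExp_of_eq hjk, hardyCoeff, if_pos hjk, if_neg (by omega)]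
      by_cases hkn' : k = n
      · rw [if_pos (by omega), if_pos hkn', if_pos (by omega)]
        nlinarith [sq_nonneg (τ k)]
      · rw [if_neg (by omega), if_neg (by omega)]
        nlinarith [sq_nonneg (τ k)]
    · rw [driftCoeff_groundExp_of_gt hk hjk, hardyCoeff, if_neg hjk.ne', if_neg (by omega : k ≠ n)]
      by_cases hjn : j + 1 = n
      · rw [if_neg (by omega), if_pos hjn, if_pos hjn, hjn, hτn]
        have : j = n - 1 := by omega
        rw [this]
        linarith
      · rw [if_pos (by omega), if_neg hjn, if_neg hjn]
        have := hτ j (by omega) (by omega)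
        linarith
  refine (mul_le_mul_of_nonneg_right key hIj).trans (le_of_eq ?_)
  rw [ite_mul, zero_mul]

/-! ### Dilation invariance and linear growth over logarithmic annuli. -/

open scoped Pointwise in
theorem smul_logAnnulus {R : ℝ} (hR : 0 < R) (a b : ℝ) :
    R • logAnnulus n a b = logAnnulus n (2 * Real.log R + a) (2 * Real.log R + b) := by
  ext x
  rw [Set.mem_smul_set_iff_inv_smul_mem₀ hR.ne']
  have hmem : R⁻¹ • x ∈ halfSpace n ↔ x ∈ halfSpace n := by
    constructor
    · rintro ⟨h, hx⟩
      exact ⟨h, by simpa [hR] using hx⟩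
    · rintro ⟨h, hx⟩
      exact ⟨h, by simpa [hR] using hx⟩
  by_cases hx : x ∈ halfSpace n
  · have hl : Real.log (partialNormSq n (R⁻¹ • x))
        = Real.log (partialNormSq n x) - 2 * Real.log R := by
      rw [partialNormSq_smul, Real.log_mul (by positivity) (partialNormSq_pos hx.1 hx).ne',
        Real.log_pow, Real.log_inv]
      push_cast
      ring
    change (_ ∧ _ ∧ _) ↔ (_ ∧ _ ∧ _)
    rw [hmem, hl]
    constructor
    · rintro ⟨h1, h2, h3⟩
      exact ⟨h1, by linarith, by linarith⟩
    · rintro ⟨h1, h2, h3⟩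
      exact ⟨h1, by linarith, by linarith⟩
  · exact ⟨fun h => absurd (hmem.1 h.1) hx, fun h => absurd h.1 hx⟩

theorem integrableOn_groundState_sq_mul_inv {s : ℕ → ℝ} (h0 : s 0 = 0) {r : ℝ} (hr : -1 < r)
    (hr0 : r ≤ 0) (hs : ∀ j, 1 ≤ j → j < n → r * j / 2 ≤ s j) (a b : ℝ) :
    IntegrableOn (fun x : EuclideanSpace ℝ (Fin n) =>
      groundState s x ^ 2 * (partialNormSq n x)⁻¹) (logAnnulus n a b) := by
  refine Integrable.mono' ((integrableOn_groundState_sq h0 hr hr0 hs a b).mul_const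
    (Real.exp (-a))) ?_ ?_
  · refine ContinuousOn.aestronglyMeasurable ?_ (measurableSet_logAnnulus a b)
    refine (((continuousOn_groundState s).pow 2).mono fun x hx => hx.1).mul ?_
    exact (continuous_partialNormSq n).continuousOn.inv₀
      fun x hx => (partialNormSq_pos hx.1.1 hx.1).ne'
  · rw [ae_restrict_iff' (measurableSet_logAnnulus a b)]
    refine Eventually.of_forall fun x hx => ?_
    have hN := partialNormSq_pos hx.1.1 hx.1
    rw [Real.norm_of_nonneg (by positivity), Real.exp_neg]
    have := (Real.le_log_iff_exp_le hN).1 hx.2.1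
    gcongr

-- The condition on s_n makes the integrand homogeneous of degree -n, so the dilation by e^c
-- preserves its integral and shifts log |x|² by 2c.
open scoped Pointwise in
theorem setIntegral_logAnnulus_shift {s : ℕ → ℝ} (h0 : s 0 = 0)
    (hsn : 2 * s n - 2 = -(n : ℝ)) (a b c : ℝ) :
    ∫ x in logAnnulus n (2 * c + a) (2 * c + b), groundState s x ^ 2 * (partialNormSq n x)⁻¹
      = ∫ x in logAnnulus n a b, groundState s x ^ 2 * (partialNormSq n x)⁻¹ := by
  have hR := Real.exp_pos c
  have h := Measure.setIntegral_comp_smul_of_pos (volume : Measure (EuclideanSpace ℝ (Fin n)))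
    (fun x => groundState s x ^ 2 * (partialNormSq n x)⁻¹) (logAnnulus n a b) hR
  rw [smul_logAnnulus hR, Real.log_exp, finrank_euclideanSpace_fin, smul_eq_mul] at h
  have hpt : ∀ x ∈ logAnnulus n a b,
      groundState s (Real.exp c • x) ^ 2 * (partialNormSq n (Real.exp c • x))⁻¹
        = (Real.exp c ^ n)⁻¹ * (groundState s x ^ 2 * (partialNormSq n x)⁻¹) := by
    intro x hx
    rw [groundState_sq_smul h0 hR hx.1, partialNormSq_smul, Real.log_exp, mul_inv]
    have e : Real.exp (2 * s n * c) * (Real.exp c ^ 2)⁻¹ = (Real.exp c ^ n)⁻¹ := by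
      rw [← Real.exp_nat_mul, ← Real.exp_nat_mul, ← Real.exp_neg, ← Real.exp_neg, ← Real.exp_add]
      congr 1
      push_cast
      linear_combination c * hsn
    rw [← e]
    ring
  rw [setIntegral_congr_fun (measurableSet_logAnnulus a b) hpt, integral_const_mul] at h
  exact (mul_left_cancel₀ (inv_ne_zero (pow_pos hR n).ne') h).symm

/-- The range is covered by m blocks of length 2, all of equal integral by invariance; the extra 1
gives room for the degenerate annulus m = 0. -/
theorem setIntegral_logAnnulus_le {s : ℕ → ℝ} (h0 : s 0 = 0) (hsn : 2 * s n - 2 = -(n : ℝ))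
    {r : ℝ} (hr : -1 < r) (hr0 : r ≤ 0) (hs : ∀ j, 1 ≤ j → j < n → r * j / 2 ≤ s j) (a : ℝ)
    (m : ℕ) :
    ∫ x in logAnnulus n a (a + 2 * m), groundState s x ^ 2 * (partialNormSq n x)⁻¹
      ≤ (m + 1) * ∫ x in logAnnulus n 0 2, groundState s x ^ 2 * (partialNormSq n x)⁻¹ := by
  set F := fun x : EuclideanSpace ℝ (Fin n) => groundState s x ^ 2 * (partialNormSq n x)⁻¹
  have hF0 : ∀ x, 0 ≤ F x := fun x =>
    mul_nonneg (sq_nonneg _) (inv_nonneg.2 (partialNormSq_nonneg n x))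
  have hF : ∀ a b, IntegrableOn F (logAnnulus n a b) :=
    integrableOn_groundState_sq_mul_inv h0 hr hr0 hs
  have hone : ∀ c, ∫ x in logAnnulus n c (c + 2), F x = ∫ x in logAnnulus n 0 2, F x := fun c => by
    have := setIntegral_logAnnulus_shift h0 hsn 0 2 (c / 2)
    rwa [show 2 * (c / 2) + 0 = c by ring, show 2 * (c / 2) + 2 = c + 2 by ring] at this
  induction m with
  | zero =>
    have h1 : logAnnulus n a (a + 2 * (0 : ℕ)) ⊆ logAnnulus n a (a + 2) :=
      logAnnulus_subset le_rfl (by simp)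
    calc _ ≤ ∫ x in logAnnulus n a (a + 2), F x :=
          setIntegral_mono_set (hF _ _) (Eventually.of_forall hF0) h1.eventuallyLE
      _ = _ := by rw [hone]; simp
  | succ m ih =>
    have h1 : logAnnulus n a (a + 2 * (m + 1 : ℕ)) ⊆
        logAnnulus n a (a + 2 * m) ∪ logAnnulus n (a + 2 * m) (a + 2 * m + 2) := by
      rintro x ⟨hx, h1, h2⟩
      push_cast at h2
      rcases le_total (Real.log (partialNormSq n x)) (a + 2 * m) with h | h
      · exact Or.inl ⟨hx, h1, h⟩
      · exact Or.inr ⟨hx, h, by linarith⟩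
    calc _ ≤ ∫ x in logAnnulus n a (a + 2 * m) ∪ logAnnulus n (a + 2 * m) (a + 2 * m + 2), F x :=
          setIntegral_mono_set ((hF _ _).union (hF _ _)) (Eventually.of_forall hF0)
            h1.eventuallyLE
      _ ≤ (∫ x in logAnnulus n a (a + 2 * m), F x)
            + ∫ x in logAnnulus n (a + 2 * m) (a + 2 * m + 2), F x := by
          rw [← integral_add_measure (hF _ _) (hF _ _)]
          refine integral_mono_measure (Measure.restrict_union_le _ _)
            (Eventually.of_forall hF0) (Integrable.add_measure (hF _ _) (hF _ _))
      _ ≤ _ := by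
          rw [hone]
          push_cast
          linarith

/-! ### A uniform lower bound for the critical norm of the test functions. -/

theorem abs_groundExp_le {k : ℕ} {τ : ℕ → ℝ} (hτ : ∀ j, 0 ≤ τ j ∧ τ j ≤ 1) {j : ℕ} (hj : j ≤ n) :
    |groundExp k τ j| ≤ n + 2 := by
  have hjn : (j : ℝ) ≤ n := by exact_mod_cast hj
  have hj0 : (0 : ℝ) ≤ j := j.cast_nonneg
  have := hτ j
  rw [groundExp, abs_le]
  split_ifs
  · constructor <;> linarith
  · constructor <;> linarith
  · constructor <;> linarith

theorem coord_and_log_bounds_of_mem_ball (hn : 0 < n) {x : EuclideanSpace ℝ (Fin n)}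
    (hx : x ∈ Metric.ball (EuclideanSpace.single (⟨0, hn⟩ : Fin n) (1 : ℝ)) (1 / 4)) :
    3 / 4 ≤ x ⟨0, hn⟩ ∧ ∀ j, 0 < j → |Real.log (partialNormSq j x)| ≤ 1 := by
  rw [mem_ball_iff_norm] at hx
  have h1 : |x ⟨0, hn⟩ - 1| ≤ 1 / 4 := by
    have h := sq_le_partialNormSq (x - EuclideanSpace.single (⟨0, hn⟩ : Fin n) (1 : ℝ)) ⟨0, hn⟩ hn
    rw [partialNormSq_self] at h
    have h' : (x - EuclideanSpace.single (⟨0, hn⟩ : Fin n) (1 : ℝ)) ⟨0, hn⟩ = x ⟨0, hn⟩ - 1 := by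
      simp
    rw [h'] at h
    exact (abs_le_of_sq_le_sq h (norm_nonneg _) : |x ⟨0, hn⟩ - 1| ≤ _) |>.trans hx.le
  have h2 : ‖x‖ ≤ 5 / 4 := by
    have := norm_le_norm_add_norm_sub' x (EuclideanSpace.single (⟨0, hn⟩ : Fin n) (1 : ℝ))
    have h3 : ‖EuclideanSpace.single (⟨0, hn⟩ : Fin n) (1 : ℝ)‖ = 1 := by simp
    linarith
  have h3 : 3 / 4 ≤ x ⟨0, hn⟩ := by linarith [(abs_le.1 h1).1]
  refine ⟨h3, fun j hj => ?_⟩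
  have hlow : 9 / 16 ≤ partialNormSq j x := by
    have := sq_le_partialNormSq x ⟨0, hn⟩ hj
    nlinarith
  have hup : partialNormSq j x ≤ 25 / 16 := by
    have h4 : partialNormSq j x ≤ partialNormSq n x := by
      rw [partialNormSq_eq, partialNormSq_eq]
      refine Finset.sum_le_sum fun i _ => ?_
      rw [if_pos i.2]
      split_ifs
      · exact le_rfl
      · positivity
    rw [partialNormSq_self] at h4
    nlinarith [norm_nonneg x]
  have hpos : 0 < partialNormSq j x := by linarith
  rw [abs_le]
  constructor
  · have := Real.one_sub_inv_le_log_of_pos hpos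
    have h5 : (partialNormSq j x)⁻¹ ≤ 2 := by
      rw [inv_le_comm₀ hpos two_pos]; linarith
    linarith
  · have := Real.log_le_sub_one_of_pos hpos
    linarith

/-- On a fixed ball around the first unit vector the cutoff is 1 and all log |X_j|² are bounded, so
Φ is bounded below. What matters is that L is independent of τ and of the cutoff. -/
theorem exists_le_integral_groundState_mul (hn : 0 < n) {c : ℝ} (hc : 0 < c) :
    ∃ L : ℝ, 0 < L ∧ ∀ (k : ℕ) (τ : ℕ → ℝ), (∀ j, 0 ≤ τ j ∧ τ j ≤ 1) →
      ∀ v : EuclideanSpace ℝ (Fin n) → ℝ, IsTestFunction (halfSpace n) v →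
        (∀ x ∈ halfSpace n, 3 / 4 ≤ x ⟨0, hn⟩ → |Real.log (partialNormSq n x)| ≤ 1 → v x = 1) →
          L ≤ ∫ x, |groundState (groundExp k τ) x * v x| ^ c := by
  set K : Set (EuclideanSpace ℝ (Fin n)) :=
    Metric.ball (EuclideanSpace.single ⟨0, hn⟩ (1 : ℝ)) (1 / 4) with hK
  have hKvol : 0 < (volume : Measure (EuclideanSpace ℝ (Fin n))).real K :=
    ENNReal.toReal_pos (Metric.measure_ball_pos _ _ (by norm_num)).ne' measure_ball_lt_top.ne
  set l : ℝ := Real.exp (-(n * (n + 2))) with hl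
  refine ⟨(volume : Measure (EuclideanSpace ℝ (Fin n))).real K * l ^ c, by positivity,
    fun k τ hτ v hv hv1 => ?_⟩
  have hKprop : ∀ x ∈ K, 3 / 4 ≤ x ⟨0, hn⟩ ∧
      ∀ j, 0 < j → |Real.log (partialNormSq j x)| ≤ 1 := fun x hx =>
    coord_and_log_bounds_of_mem_ball hn hx
  have hKh : K ⊆ halfSpace n := fun x hx =>
    (mem_halfSpace hn).2 (by linarith [(hKprop x hx).1])
  have hu := hv.groundState_mul (groundExp k τ)
  have hint : Integrable fun x => |groundState (groundExp k τ) x * v x| ^ c :=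
    (hu.continuous_abs_rpow hc).integrable_of_hasCompactSupport (hu.hasCompactSupport_abs_rpow hc)
  have hlb : ∀ x ∈ K, l ^ c ≤ |groundState (groundExp k τ) x * v x| ^ c := by
    intro x hx
    obtain ⟨h1, h2⟩ := hKprop x hx
    rw [hv1 x (hKh hx) h1 (h2 n hn), mul_one, abs_of_pos (groundState_pos _ x)]
    refine Real.rpow_le_rpow (Real.exp_pos _).le ?_ hc.le
    rw [hl, groundState, Real.exp_le_exp]
    calc -((n : ℝ) * (n + 2)) = ∑ _j ∈ Finset.range n, -((n : ℝ) + 2) := by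
          rw [Finset.sum_const, Finset.card_range, nsmul_eq_mul, mul_neg]
      _ ≤ _ := by
        refine Finset.sum_le_sum fun j hj => ?_
        have hj := Finset.mem_range.1 hj
        have a1 := abs_groundExp_le (k := k) hτ (show j + 1 ≤ n from hj)
        have a2 := abs_groundExp_le (k := k) hτ hj.le
        have a3 : |(groundExp k τ (j + 1) - groundExp k τ j) / 2| ≤ n + 2 := by
          rw [abs_div, abs_two, div_le_iff₀ two_pos]
          have := abs_sub (groundExp k τ (j + 1)) (groundExp k τ j)
          linarith
        have a4 := h2 (j + 1) j.succ_pos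
        have a5 := mul_le_mul a3 a4 (abs_nonneg _) (by positivity)
        rw [← abs_mul, mul_one] at a5
        exact (abs_le.1 a5).1
  calc _ = ∫ _x in K, l ^ c := by rw [setIntegral_const, smul_eq_mul]
    _ ≤ ∫ x in K, |groundState (groundExp k τ) x * v x| ^ c :=
        setIntegral_mono_on (integrableOn_const measure_ball_lt_top.ne) hint.integrableOn
          Metric.isOpen_ball.measurableSet hlb
    _ ≤ _ := setIntegral_le_integral hint (Eventually.of_forall fun x => by positivity)

/-! ### Perturbed exponents and estimates for the test functions. -/

/-- The perturbation of the exponents, satisfying `τ_j = τ_{j+1}² / 2` for `j + 1 < n`. -/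
def perturbation (n : ℕ) (ε : ℝ) (j : ℕ) : ℝ :=
  if j = n then 0 else 2 * (ε / 2) ^ 2 ^ (n - 1 - j)

theorem perturbation_self (n : ℕ) (ε : ℝ) : perturbation n ε n = 0 := if_pos rfl

theorem perturbation_mem {ε : ℝ} (h0 : 0 < ε) (h1 : ε ≤ 1) (j : ℕ) :
    0 ≤ perturbation n ε j ∧ perturbation n ε j ≤ 1 := by
  rw [perturbation]
  split_ifs
  · simp
  · refine ⟨by positivity, ?_⟩
    have := pow_le_of_le_one (show 0 ≤ ε / 2 by positivity) (by linarith)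
      (pow_ne_zero (n - 1 - j) two_ne_zero)
    linarith

theorem le_perturbation {ε : ℝ} (h0 : 0 < ε) (h1 : ε ≤ 1) {j : ℕ} (hj : j < n) :
    2 * (ε / 2) ^ 2 ^ n ≤ perturbation n ε j := by
  rw [perturbation, if_neg hj.ne]
  refine mul_le_mul_of_nonneg_left (pow_le_pow_of_le_one (by positivity) (by linarith) ?_) two_pos.le
  exact Nat.pow_le_pow_right two_pos (by omega)

theorem perturbation_sq_add_le {ε : ℝ} (h0 : 0 < ε) (h1 : ε ≤ 1) {j : ℕ} (hj : j + 1 < n) :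
    perturbation n ε j ^ 2 + perturbation n ε j ≤ perturbation n ε (j + 1) ^ 2 := by
  have hm := perturbation_mem (n := n) h0 h1 j
  have e : perturbation n ε (j + 1) ^ 2 = 2 * perturbation n ε j := by
    rw [perturbation, perturbation, if_neg (by omega), if_neg (by omega),
      show n - 1 - j = (n - 1 - (j + 1)) + 1 by omega, pow_succ 2, pow_mul]
    ring
  rw [e]
  nlinarith [hm.1, hm.2]

theorem perturbation_pred (hn : 0 < n) (ε : ℝ) : perturbation n ε (n - 1) = ε := by
  rw [perturbation, if_neg (by omega)]
  simp
  ring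

theorem groundState_sq_groundExp_le {k : ℕ} {τ : ℕ → ℝ} (hτ : ∀ j, 0 ≤ τ j) (hτn : τ n = 0)
    {x : EuclideanSpace ℝ (Fin n)} (hx : x ∈ halfSpace n) :
    groundState (groundExp k τ) x ^ 2 ≤ groundState (groundExp k 0) x ^ 2 := by
  have h := groundState_sq_le (s := groundExp k τ) (s' := groundExp k 0)
    (by rw [groundExp_zero, groundExp_zero]) (fun j _ _ => ?_) hx
  · have e : groundExp k τ n - groundExp k 0 n = 0 := by
      simp only [groundExp, hτn, Pi.zero_apply]
      split_ifs <;> simp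
    rwa [e, zero_mul, Real.exp_zero, one_mul] at h
  · have := hτ j
    simp only [groundExp, Pi.zero_apply]
    split_ifs <;> linarith

/-- The comparison exponent r = -1 + 2/n works because j/n ≤ 1. Its properties are exported for
reuse in `setIntegral_logAnnulus_le`. -/
theorem integrableOn_groundState_zero (hn : 2 ≤ n) (k : ℕ) (a b : ℝ) :
    IntegrableOn (fun x : EuclideanSpace ℝ (Fin n) =>
      groundState (groundExp k 0) x ^ 2 * (partialNormSq n x)⁻¹) (logAnnulus n a b) ∧
    -1 < -1 + 2 / (n : ℝ) ∧ -1 + 2 / (n : ℝ) ≤ 0 ∧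
    ∀ j, 1 ≤ j → j < n → (-1 + 2 / (n : ℝ)) * j / 2 ≤ groundExp k 0 j := by
  have hn' : (2 : ℝ) ≤ n := by exact_mod_cast hn
  have hn0 : (0 : ℝ) < n := by linarith
  have h1 : -1 < -1 + 2 / (n : ℝ) := by linarith [div_pos two_pos hn0]
  have h2 : -1 + 2 / (n : ℝ) ≤ 0 := by
    have := (div_le_one hn0).2 hn'
    linarith
  have h3 : ∀ j, 1 ≤ j → j < n → (-1 + 2 / (n : ℝ)) * j / 2 ≤ groundExp k 0 j := by
    intro j hj hjn
    have hj' : (1 : ℝ) ≤ j := by exact_mod_cast hj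
    have hjn' : (j : ℝ) < n := by exact_mod_cast hjn
    by_cases hjk : j < k
    · rw [groundExp_of_lt (by omega) hjk]
      nlinarith
    · rw [groundExp_of_le (by omega) (by omega), Pi.zero_apply]
      have : 2 / (n : ℝ) * j ≤ 2 := by
        rw [div_mul_eq_mul_div, div_le_iff₀ hn0]
        linarith
      linarith
  exact ⟨integrableOn_groundState_sq_mul_inv (groundExp_zero k 0) h1 h2 h3 a b, h1, h2, h3⟩

/-- Here the perturbation pays off: dividing by x_1² lowers every s_j, j ≥ 1, by one, to the
borderline -j/2 for j ≥ k, and τ_j ≥ θ > 0 leaves room for an r > -1. -/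
theorem integrableOn_groundState_mul_inv_one {k : ℕ} {τ : ℕ → ℝ} {θ : ℝ} (hθ : 0 < θ)
    (hθ1 : θ ≤ 1) (hτ : ∀ j < n, θ ≤ τ j) (a b : ℝ) :
    IntegrableOn (fun x : EuclideanSpace ℝ (Fin n) =>
      groundState (groundExp k τ) x ^ 2 * (partialNormSq 1 x)⁻¹) (logAnnulus n a b) := by
  rcases Nat.eq_zero_or_pos n with rfl | hn
  · have : logAnnulus 0 a b = ∅ := eq_empty_of_forall_notMem fun x hx => absurd hx.1.1 (by omega)
    rw [this]
    exact integrableOn_empty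
  have hn0 : (0 : ℝ) < n := by exact_mod_cast hn
  have hn1 : (1 : ℝ) ≤ n := by exact_mod_cast hn
  let s : ℕ → ℝ := fun j => if j = 0 then 0 else groundExp k τ j - 1
  have hs : ∀ j, 1 ≤ j → j < n → (-1 + θ / n) * j / 2 ≤ s j := by
    intro j hj hjn
    have hj' : (1 : ℝ) ≤ j := by exact_mod_cast hj
    have hjn' : (j : ℝ) < n := by exact_mod_cast hjn
    have h1 : θ / n * j ≤ θ := by
      rw [div_mul_eq_mul_div, div_le_iff₀ hn0]
      nlinarith
    have h2 := hτ j hjn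
    simp only [s, if_neg (show j ≠ 0 by omega)]
    by_cases hjk : j < k
    · rw [groundExp_of_lt (by omega) hjk]
      linarith
    · rw [groundExp_of_le (by omega) (by omega)]
      linarith
  have h := integrableOn_groundState_sq (s := s) (if_pos rfl) (r := -1 + θ / n)
    (by linarith [div_pos hθ hn0]) (by
      have : θ / n ≤ 1 := (div_le_one hn0).2 (by linarith)
      linarith) hs a b
  refine h.congr_fun (fun x hx => ?_) (measurableSet_logAnnulus a b)
  have hN := partialNormSq_pos one_pos hx.1
  simp only
  rw [groundState_sq, groundState_sq, ← Real.exp_log (inv_pos.2 hN), ← Real.exp_add, Real.log_inv]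
  congr 1
  obtain ⟨m, rfl⟩ : ∃ m, n = m + 1 := ⟨n - 1, by omega⟩
  rw [Finset.sum_range_succ', Finset.sum_range_succ', add_assoc]
  refine congrArg₂ _ (Finset.sum_congr rfl fun j _ => ?_) ?_
  · simp [s]
  · simp [s, groundExp_zero]
    ring

/-- The logarithmic term is compared with the unperturbed state `s₀`, whose bound must not depend on
the perturbation. The strip term keeps `s`, for which integrability against x_1^{-2} is available.
-/
theorem integral_groundState_mul_gradient_cutoff_le (hn : 0 < n) {η ψ : ℝ → ℝ} {C₁ C₂ : ℝ}
    (hη : ContDiff ℝ (⊤ : ℕ∞) η) (hη1 : ∀ t, 0 ≤ η t ∧ η t ≤ 1) (hη0 : ∀ t ≤ 1, η t = 0)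
    (hηC : ∀ t, |deriv η t| ≤ C₁) (hηd : ∀ t, 2 < t → deriv η t = 0)
    (hψ : ContDiff ℝ (⊤ : ℕ∞) ψ) (hψ1 : ∀ t, 0 ≤ ψ t ∧ ψ t ≤ 1) (hψC : ∀ t, |deriv ψ t| ≤ C₂)
    (hψ0 : ∀ t, 2 ≤ |t| → ψ t = 0) (hψd : ∀ t, 2 < |t| → deriv ψ t = 0)
    {δ m : ℝ} (hδ : 0 < δ) (hm : 0 < m) {s s₀ : ℕ → ℝ}
    (hle : ∀ x ∈ halfSpace n, groundState s x ^ 2 ≤ groundState s₀ x ^ 2)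
    (hI₀ : IntegrableOn (fun x : EuclideanSpace ℝ (Fin n) =>
      groundState s₀ x ^ 2 * (partialNormSq n x)⁻¹) (logAnnulus n (-(2 * m)) (2 * m)))
    (hI : IntegrableOn (fun x : EuclideanSpace ℝ (Fin n) =>
      groundState s x ^ 2 * (partialNormSq 1 x)⁻¹) (logAnnulus n (-(2 * m)) (2 * m))) :
    ∫ x, groundState s x ^ 2 * ‖gradient (cutoff hn η ψ δ m) x‖ ^ 2
      ≤ 8 * C₂ ^ 2 / m ^ 2 * (∫ x in logAnnulus n (-(2 * m)) (2 * m),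
          groundState s₀ x ^ 2 * (partialNormSq n x)⁻¹)
        + 8 * C₁ ^ 2 * ∫ x in logAnnulus n (-(2 * m)) (2 * m) ∩ {x | partialNormSq 1 x ≤ 4 * δ ^ 2},
          groundState s x ^ 2 * (partialNormSq 1 x)⁻¹ := by
  set A := logAnnulus n (-(2 * m)) (2 * m) with hA
  set S := {x : EuclideanSpace ℝ (Fin n) | partialNormSq 1 x ≤ 4 * δ ^ 2} with hS
  have hAm : MeasurableSet A := measurableSet_logAnnulus _ _
  have hSm : MeasurableSet S := measurableSet_le (continuous_partialNormSq 1).measurable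
    measurable_const
  have hv := isTestFunction_cutoff hn hη hη0 hψ hψ0 hδ hm
  have i1 := IntegrableOn.integrable_indicator (hI₀.const_mul (8 * C₂ ^ 2 / m ^ 2)) hAm
  have i2 := IntegrableOn.integrable_indicator ((hI.mono_set
    (inter_subset_left (t := S))).const_mul (8 * C₁ ^ 2)) (hAm.inter hSm)
  have hpt : ∀ x, groundState s x ^ 2 * ‖gradient (cutoff hn η ψ δ m) x‖ ^ 2
      ≤ A.indicator (fun x => 8 * C₂ ^ 2 / m ^ 2 *
          (groundState s₀ x ^ 2 * (partialNormSq n x)⁻¹)) x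
        + (A ∩ S).indicator (fun x => 8 * C₁ ^ 2 *
          (groundState s x ^ 2 * (partialNormSq 1 x)⁻¹)) x := by
    intro x
    have n1 : ∀ j, 0 ≤ (partialNormSq j x)⁻¹ := fun j => inv_nonneg.2 (partialNormSq_nonneg j x)
    by_cases hx : x ∈ halfSpace n
    · have h1 := mul_le_mul_of_nonneg_left
        (norm_gradient_cutoff_sq_le hn hη hη1 hηC hηd hψ hψ1 hψC hψ0 hψd hδ hm hx)
        (sq_nonneg (groundState s x))
      refine h1.trans ?_
      rw [← hA]
      by_cases hxA : x ∈ A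
      · have h2 : groundState s x ^ 2 * (8 * C₂ ^ 2 / m ^ 2 * (partialNormSq n x)⁻¹)
            ≤ 8 * C₂ ^ 2 / m ^ 2 * (groundState s₀ x ^ 2 * (partialNormSq n x)⁻¹) := by
          have := mul_le_mul_of_nonneg_right (hle x hx)
            (show 0 ≤ 8 * C₂ ^ 2 / m ^ 2 * (partialNormSq n x)⁻¹ from
              mul_nonneg (by positivity) (n1 n))
          linarith
        rw [indicator_of_mem hxA, indicator_of_mem hxA, mul_add]
        refine add_le_add h2 (le_of_eq ?_)
        by_cases hxS : x ∈ S
        · rw [indicator_of_mem hxS, indicator_of_mem (show x ∈ A ∩ S from ⟨hxA, hxS⟩)]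
          ring
        · rw [indicator_of_notMem hxS, indicator_of_notMem fun h => hxS h.2, mul_zero]
      · rw [indicator_of_notMem hxA, indicator_of_notMem hxA,
          indicator_of_notMem fun h => hxA h.1]
        simp
    · rw [gradient_eq_zero_of_notMem hv hx, indicator_of_notMem fun h => hx h.1,
        indicator_of_notMem fun h => hx h.1.1]
      simp
  refine (integral_mono_of_nonneg (Eventually.of_forall fun x => by positivity) (i1.add i2)
    (Eventually.of_forall hpt)).trans (le_of_eq ?_)
  rw [integral_add' i1 i2, integral_indicator hAm, integral_indicator (hAm.inter hSm),
    integral_const_mul, integral_const_mul]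

theorem integral_inv_mul_groundState_cutoff_le (hn : 0 < n) {η ψ : ℝ → ℝ}
    (hη1 : ∀ t, 0 ≤ η t ∧ η t ≤ 1) (hη0 : ∀ t ≤ 1, η t = 0)
    (hψ1 : ∀ t, 0 ≤ ψ t ∧ ψ t ≤ 1) (hψ0 : ∀ t, 2 ≤ |t| → ψ t = 0)
    {δ m : ℝ} (hδ : 0 < δ) (hm : 0 < m) {s s₀ : ℕ → ℝ}
    (hle : ∀ x ∈ halfSpace n, groundState s x ^ 2 ≤ groundState s₀ x ^ 2)
    (hI₀ : IntegrableOn (fun x : EuclideanSpace ℝ (Fin n) =>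
      groundState s₀ x ^ 2 * (partialNormSq n x)⁻¹) (logAnnulus n (-(2 * m)) (2 * m))) :
    ∫ x, (partialNormSq n x)⁻¹ * (groundState s x * cutoff hn η ψ δ m x) ^ 2
      ≤ ∫ x in logAnnulus n (-(2 * m)) (2 * m),
          groundState s₀ x ^ 2 * (partialNormSq n x)⁻¹ := by
  have hAm := measurableSet_logAnnulus (n := n) (-(2 * m)) (2 * m)
  rw [← integral_indicator hAm]
  refine integral_mono_of_nonneg (Eventually.of_forall fun x =>
    mul_nonneg (inv_nonneg.2 (partialNormSq_nonneg n x)) (sq_nonneg _))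
    (hI₀.integrable_indicator hAm) (Eventually.of_forall fun x => ?_)
  have n1 : 0 ≤ (partialNormSq n x)⁻¹ := inv_nonneg.2 (partialNormSq_nonneg n x)
  simp only
  by_cases hxA : x ∈ logAnnulus n (-(2 * m)) (2 * m)
  · rw [indicator_of_mem hxA]
    have h1 : cutoff hn η ψ δ m x ^ 2 ≤ 1 := by
      have a := hη1 (x ⟨0, hn⟩ / δ)
      have b := hψ1 (Real.log (partialNormSq n x) / m)
      exact pow_le_one₀ (mul_nonneg a.1 b.1) (mul_le_one₀ a.2 b.1 b.2)
    calc _ = (partialNormSq n x)⁻¹ * (groundState s x ^ 2 * cutoff hn η ψ δ m x ^ 2) := by ring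
      _ ≤ (partialNormSq n x)⁻¹ * (groundState s₀ x ^ 2 * 1) := by
          have := hle x hxA.1
          gcongr
      _ = _ := by ring
  · rw [indicator_of_notMem hxA]
    have h0 : cutoff hn η ψ δ m x = 0 := by
      by_cases hx : x ∈ halfSpace n
      · rw [cutoff, hψ0, mul_zero]
        by_contra h
        rw [not_le, abs_lt, lt_div_iff₀ hm, div_lt_iff₀ hm] at h
        exact hxA ⟨hx, by linarith [h.1], h.2.le⟩
      · rw [mem_halfSpace hn, not_lt] at hx
        rw [cutoff, hη0 _ ((div_nonpos_of_nonpos_of_nonneg hx hδ.le).trans zero_le_one), zero_mul]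
    rw [h0]
    simp

/-- The strips decrease to the empty set, because x_1 > 0 throughout the half-space. -/
theorem tendsto_setIntegral_boundary_strip {a b : ℝ}
    {F : EuclideanSpace ℝ (Fin n) → ℝ} (hF : IntegrableOn F (logAnnulus n a b)) :
    Tendsto (fun i : ℕ => ∫ x in logAnnulus n a b ∩
      {x | partialNormSq 1 x ≤ 4 * ((3 / 8) * (1 / ((i : ℝ) + 1))) ^ 2}, F x) atTop (𝓝 0) := by
  set A : ℕ → Set (EuclideanSpace ℝ (Fin n)) := fun i => logAnnulus n a b ∩
      {x | partialNormSq 1 x ≤ 4 * ((3 / 8) * (1 / ((i : ℝ) + 1))) ^ 2} with hA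
  have hmeas : ∀ i, MeasurableSet (A i) := fun i => (measurableSet_logAnnulus a b).inter
    (measurableSet_le (continuous_partialNormSq 1).measurable measurable_const)
  have hanti : Antitone A := by
    intro i j hij x hx
    have hij' : (i : ℝ) ≤ j := by exact_mod_cast hij
    refine ⟨hx.1, (show partialNormSq 1 x ≤ _ from hx.2).trans ?_⟩
    gcongr
  have h := tendsto_setIntegral_of_antitone hmeas hanti
    ⟨0, hF.mono_set inter_subset_left⟩
  have hempty : ⋂ i, A i = ∅ := by
    refine eq_empty_of_forall_notMem fun x hx => ?_
    rw [mem_iInter] at hx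
    have hpos := partialNormSq_pos one_pos (hx 0).1.1
    have hlim : Tendsto (fun i : ℕ => 4 * ((3 / 8 : ℝ) * (1 / ((i : ℝ) + 1))) ^ 2) atTop
        (𝓝 (4 * ((3 / 8) * 0) ^ 2)) :=
      ((tendsto_one_div_add_atTop_nhds_zero_nat.const_mul _).pow 2).const_mul _
    have := ge_of_tendsto' hlim fun i => (hx i).2
    norm_num at this
    linarith
  rwa [hempty, setIntegral_empty] at h

/-- The order of limits is essential: for fixed m, hence fixed perturbation, the strip term vanishes
as δ → 0, with no rate uniform in m needed. Only then does m tend to infinity. -/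
theorem not_hardySobolevMazya (hn : 3 ≤ n) {k : ℕ} (hk : 1 ≤ k) (hkn : k ≤ n) :
    ¬ ∃ C : ℝ, 0 < C ∧
      HardySobolevMazya n (hardyPotential n k (if k = n then 0 else 1 / 4)) C := by
  rintro ⟨C, hC, H⟩
  have hn0 : 0 < n := by omega
  have hn' : (3 : ℝ) ≤ n := by exact_mod_cast hn
  have hcrit : 0 < criticalExponent n := by
    rw [criticalExponent]
    have : (0 : ℝ) < n - 2 := by linarith
    positivity
  obtain ⟨η, C₁, hη, hη1, hη0, hη2, hηC, hηd⟩ := exists_smooth_step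
  obtain ⟨ψ, C₂, hψ, hψ1, hψ2, hψ0, hψC, hψd⟩ := exists_smooth_bump
  obtain ⟨L, hL, hLle⟩ := exists_le_integral_groundState_mul hn0 hcrit
  set J : ℝ := ∫ x in logAnnulus n 0 2,
    groundState (groundExp k 0) x ^ 2 * (partialNormSq n x)⁻¹ with hJ
  have hJ0 : 0 ≤ J := integral_nonneg fun x =>
    mul_nonneg (sq_nonneg _) (inv_nonneg.2 (partialNormSq_nonneg n x))
  have main : ∀ m : ℕ, 1 ≤ m → C * L ^ (2 / criticalExponent n)
      ≤ (8 * C₂ ^ 2 + 2) * (3 * J) / m := by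
    intro m hm
    have hm1 : (1 : ℝ) ≤ m := by exact_mod_cast hm
    have hm0 : (0 : ℝ) < m := by linarith
    -- Matches the m^{-2} of the logarithmic cutoff; both errors multiply an integral of size O(m).
    set ε : ℝ := 1 / (m : ℝ) ^ 2 with hε
    have hε0 : 0 < ε := by positivity
    have hε1 : ε ≤ 1 := by
      rw [hε, div_le_one (by positivity)]
      exact one_le_pow₀ hm1
    set τ := perturbation n ε with hτ
    have hτmem := perturbation_mem (n := n) hε0 hε1
    obtain ⟨hI₀, hr, hr0, hs⟩ := integrableOn_groundState_zero (n := n) (by omega) k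
      (-(2 * (m : ℝ))) (2 * m)
    have hle : ∀ x ∈ halfSpace n,
        groundState (groundExp k τ) x ^ 2 ≤ groundState (groundExp k 0) x ^ 2 := fun x hx =>
      groundState_sq_groundExp_le (fun j => (hτmem j).1) (perturbation_self n ε) hx
    have hI : IntegrableOn (fun x : EuclideanSpace ℝ (Fin n) =>
        groundState (groundExp k τ) x ^ 2 * (partialNormSq 1 x)⁻¹)
        (logAnnulus n (-(2 * (m : ℝ))) (2 * m)) :=
      integrableOn_groundState_mul_inv_one (θ := 2 * (ε / 2) ^ 2 ^ n) (by positivity)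
        ((le_perturbation hε0 hε1 hn0).trans (hτmem 0).2)
        (fun j hj => le_perturbation hε0 hε1 hj) _ _
    set Jm : ℝ := ∫ x in logAnnulus n (-(2 * (m : ℝ))) (2 * m),
      groundState (groundExp k 0) x ^ 2 * (partialNormSq n x)⁻¹ with hJm
    have hstep : ∀ i : ℕ, C * L ^ (2 / criticalExponent n) ≤
        8 * C₂ ^ 2 / (m : ℝ) ^ 2 * Jm + 8 * C₁ ^ 2 *
          (∫ x in logAnnulus n (-(2 * (m : ℝ))) (2 * m) ∩
            {x | partialNormSq 1 x ≤ 4 * ((3 / 8) * (1 / ((i : ℝ) + 1))) ^ 2},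
            groundState (groundExp k τ) x ^ 2 * (partialNormSq 1 x)⁻¹) + 2 * ε * Jm := by
      intro i
      -- The bound δ ≤ 3/8 ensures x_1/δ ≥ 2 wherever x_1 ≥ 3/4, so η equals 1 there.
      set δ : ℝ := (3 / 8) * (1 / ((i : ℝ) + 1)) with hδ
      have hδ0 : 0 < δ := by positivity
      have hδ1 : δ ≤ 3 / 8 := by
        have : 1 / ((i : ℝ) + 1) ≤ 1 := by
          rw [div_le_one (by positivity)]
          linarith [i.cast_nonneg (α := ℝ)]
        linarith
      set v := cutoff hn0 η ψ δ m with hvdef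
      have hv : IsTestFunction (halfSpace n) v :=
        isTestFunction_cutoff hn0 hη hη0 hψ hψ0 hδ0 hm0
      have hv1 : ∀ x ∈ halfSpace n, 3 / 4 ≤ x ⟨0, hn0⟩ →
          |Real.log (partialNormSq n x)| ≤ 1 → v x = 1 := by
        intro x _ hx1 hx2
        rw [hvdef, cutoff, hη2, hψ2, mul_one]
        · rw [abs_div, abs_of_pos hm0, div_le_one hm0]
          linarith
        · rw [le_div_iff₀ hδ0]
          linarith
      have e1 := hLle k τ hτmem v hv hv1
      have e2 := H _ (hv.groundState_mul (groundExp k τ))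
      rw [(hv.groundState_mul (groundExp k τ)).setIntegral_rpow hcrit.ne'] at e2
      have e3 := critical_energy_le hk hkn (perturbation_self n ε)
        (fun j _ hj => perturbation_sq_add_le hε0 hε1 hj) (ε := 2 * ε) (by positivity)
        (by rw [perturbation_pred hn0]; nlinarith) hv
      have e4 := integral_groundState_mul_gradient_cutoff_le hn0 hη hη1 hη0 hηC hηd hψ hψ1 hψC
        hψ0 hψd hδ0 hm0 hle hI₀ hI
      have e5 := mul_le_mul_of_nonneg_left
        (integral_inv_mul_groundState_cutoff_le hn0 hη1 hη0 hψ1 hψ0 hδ0 hm0 hle hI₀)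
        (show 0 ≤ 2 * ε by positivity)
      have e6 : C * L ^ (2 / criticalExponent n) ≤ C *
          (∫ x, |groundState (groundExp k τ) x * v x| ^ criticalExponent n)
            ^ (2 / criticalExponent n) := by gcongr
      linarith
    have hlim := (((tendsto_setIntegral_boundary_strip hI).const_mul
      (8 * C₁ ^ 2)).const_add (8 * C₂ ^ 2 / (m : ℝ) ^ 2 * Jm)).add_const (2 * ε * Jm)
    have hfin := ge_of_tendsto' hlim hstep
    rw [mul_zero, add_zero] at hfin
    have hJm_le : Jm ≤ (2 * m + 1) * J := by
      have := setIntegral_logAnnulus_le (groundExp_zero k 0) (by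
        rw [groundExp_of_le (by omega) hkn, Pi.zero_apply]; ring) hr hr0 hs (-(2 * (m : ℝ))) (2 * m)
      have e : -(2 * (m : ℝ)) + 2 * ((2 * m : ℕ) : ℝ) = 2 * m := by push_cast; ring
      rw [e] at this
      push_cast at this
      exact this
    have hJm_le' : Jm ≤ 3 * m * J := hJm_le.trans (by gcongr; linarith)
    calc _ ≤ 8 * C₂ ^ 2 / (m : ℝ) ^ 2 * Jm + 2 * ε * Jm := hfin
      _ = (8 * C₂ ^ 2 + 2) / (m : ℝ) ^ 2 * Jm := by rw [hε]; ring
      _ ≤ (8 * C₂ ^ 2 + 2) / (m : ℝ) ^ 2 * (3 * m * J) := by gcongr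
      _ = _ := by field_simp
  have hpos : 0 < C * L ^ (2 / criticalExponent n) := by positivity
  have hlim : Tendsto (fun m : ℕ => (8 * C₂ ^ 2 + 2) * (3 * J) / (m : ℝ)) atTop (𝓝 0) :=
    tendsto_const_div_atTop_nhds_zero_nat _
  have := ge_of_tendsto hlim (eventually_atTop.2 ⟨1, main⟩)
  linarith

/-- For k = n the first and last terms of the potential coincide, which turns part (ii) into the
case k = n with critical value 0 for β. -/
theorem hardyPotential_self (β : ℝ) :
    hardyPotential n n β = fun x => ((n : ℝ) ^ 2 / 4 + β) / partialNormSq n x := by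
  funext x
  rw [hardyPotential, Finset.Icc_eq_empty (by omega), Finset.sum_empty]
  ring

end

end HalfSpaceHardy

theorem mainTheorem7 (n : ℕ) (hn : 3 ≤ n) :
    (∀ k : ℕ, 1 ≤ k → k < n →
      (∀ β : ℝ, β < 1 / 4 →
        ∃ C : ℝ, 0 < C ∧
          HalfSpaceHardy.HardySobolevMazya n (HalfSpaceHardy.hardyPotential n k β) C) ∧
      ¬ ∃ C : ℝ, 0 < C ∧
          HalfSpaceHardy.HardySobolevMazya n (HalfSpaceHardy.hardyPotential n k (1 / 4)) C) ∧
    (∀ β : ℝ, β < (n : ℝ) ^ 2 / 4 →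
      ∃ C : ℝ, 0 < C ∧
        HalfSpaceHardy.HardySobolevMazya n (fun x => β / HalfSpaceHardy.partialNormSq n x) C) ∧
    ¬ ∃ C : ℝ, 0 < C ∧
        HalfSpaceHardy.HardySobolevMazya n
          (fun x => ((n : ℝ) ^ 2 / 4) / HalfSpaceHardy.partialNormSq n x) C := by
  refine ⟨fun k hk hkn => ⟨fun β hβ => ?_, ?_⟩, fun β hβ => ?_, ?_⟩
  · exact HalfSpaceHardy.exists_hardySobolevMazya hn hk hkn.le (by rwa [if_neg hkn.ne])
  · have h := HalfSpaceHardy.not_hardySobolevMazya hn hk hkn.le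
    rwa [if_neg hkn.ne] at h
  · have h := HalfSpaceHardy.exists_hardySobolevMazya hn (by omega) le_rfl
      (show β - (n : ℝ) ^ 2 / 4 < if n = n then 0 else 1 / 4 by rw [if_pos rfl]; linarith)
    rwa [HalfSpaceHardy.hardyPotential_self, add_sub_cancel] at h
  · have h := HalfSpaceHardy.not_hardySobolevMazya hn (by omega : 1 ≤ n) le_rfl
    rwa [if_pos rfl, HalfSpaceHardy.hardyPotential_self, add_zero] at h
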